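/- **Proposition (Nondestructive median estimator).** *Model.* A quantum query program acts on a data register, whose state space is a complex inner product space, and on a finite workspace that starts in $|0\rangle$. Its steps are unitaries on the workspace, calls to given black-box operators on the data register (possibly controlled by the workspace), measurements of the workspace on whose outcomes the rest of the program may depend, replacement of the workspace by a fresh one in $|0\rangle$, and halting with a classical output. A state $|\psi\rangle$ is *restored* by a run if at the end of the run the joint state is $|\psi\rangle\otimes|\phi\rangle$ for some workspace vector $|\phi\rangle$. Numbers of calls are worst-case over all measurement outcomes, and a controlled call counts as one call. *Nondestructive amplitude estimation.* A program with black boxes $\mathrm{id}-2|\psi\rangle\langle\psi|$ and $\mathrm{id}-2\Pi$, not depending on $\psi$ or $\Pi$, is a nondestructive amplitude estimation algorithm with parameters $(t,\delta)$ and constant $C$ if for every unit vector $|\psi\rangle$ and every orthogonal projection $\Pi$, when run on one copy of $|\psi\rangle$, it outputs $\tilde p\in[0,1]$ such that, with $p=\|\Pi|\psi\rangle\|^2$, one has $|\tilde p-p|<\sqrt{p(1-p)}/t+1/t^2$ with probability at least $1-\delta$, and $\tilde p=0$ with probability at least $1-\delta$ if $p\le 1/(4t^2)$; moreover it restores $|\psi\rangle$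 with probability at least $1-\delta$ and makes at most $C\,t\log(1/\delta)$ calls to the two black boxes in total. *Median estimator.* Let $X$ be a finite real random variable with support $x_1<\dots<x_n$ (the values taken with positive probability), mean $\mu$ and variance $\sigma^2$, and let $|\pi_X\rangle=\sum_x\sqrt{\Pr[X=x]}\,|x\rangle$ be its qsample. Given $\eta\in(0,1)$ put $\delta=\eta/(2(\lfloor\log_2 n\rfloor+1))$. The median estimator starts with $a=1$, $b=n+1$, and while $a<b$ it puts $k=\lfloor(a+b)/2\rfloor$, computes an estimate $\tilde p_k$ of $\Pr[X\ge x_k]$ by nondestructive amplitude estimation with parameters $(3\sqrt2,\delta)$ on the state $|\pi_X\rangle$ and the projection $\sum_{x\ge x_k}|x\rangle\langle x|$, and sets $b=k$ if $\tilde p_k\le 1/6$ and $a=k+1$ otherwise. When $a=b$ it outputs $\tilde\mu=x_{a-1}$ (and $x_1$ if $a=1$). *Statement.* There are a universal constant $C$ and, for every $\delta\in(0,1/2)$, a nondestructive amplitude estimation algorithm with parameters $(3\sqrt2,\delta)$ and constant $C$, such that for all $X$ and all $\eta\in(0,1)$ the median estimator that uses these algorithms, started on one copy of $|\pi_X\rangle$,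 satisfies: 1. $|\mu-\tilde\mu|\le 17\sigma$ with probability at least $1-\eta$; 2. $|\pi_X\rangle$ is restored with probability at least $1-\eta$; 3. it applies the reflection $\mathrm{id}-2|\pi_X\rangle\langle\pi_X|$ at most $C\,(1+\log n)\bigl(1+\log\frac{1+\log n}{\eta}\bigr)$ times, that is, $O(\log(n)\log(\log(n)/\eta))$ times. -/

import Mathlib

open MeasureTheory ProbabilityTheory

noncomputable section

/-! ## Quantum query programs

A program acts on a data register `H` (a complex inner product space that is only reachable
through black-box operators) together with a workspace with computational basis
`|0⟩, …, |w⟩`.  Its elementary steps are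
* an arbitrary unitary on the workspace,
* a call to a black-box operator of `H`, controlled by the workspace basis state,
* a (possibly partial) projective measurement of the workspace in the computational basis, on the
  outcome of which the rest of the program may depend,
* the replacement of the workspace by a fresh one in the state `|0⟩`,
* halting with a classical output.

`Q` is the type of names of the black-box operators, `α` the type of classical outputs. -/
inductive QProg (Q : Type) (w : ℕ) (α : Type) : Type
  | ret (a : α) : QProg Q w α
  | gate (U : Matrix.unitaryGroup (Fin (w + 1)) ℂ) (next : QProg Q w α) : QProg Q w α
  | query (q : Q) (ctrl : Fin (w + 1) → Bool) (next : QProg Q w α) : QProg Q w α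
  | meas (f : Fin (w + 1) → Fin (w + 1)) (next : Fin (w + 1) → QProg Q w α) : QProg Q w α
  | fresh (next : QProg Q w α) : QProg Q w α

namespace QProg

variable {Q Q' : Type} {w : ℕ} {α β : Type}

/-- Rename the black-box operators. -/
def rename (g : Q → Q') : QProg Q w α → QProg Q' w α
  | ret a => ret a
  | gate U next => gate U (next.rename g)
  | query q c next => query (g q) c (next.rename g)
  | meas f next => meas f fun o => (next o).rename g
  | fresh next => fresh (next.rename g)

/-- Sequential composition: run a program, then continue, on the data register that it leaves and
with a fresh workspace, with a program that depends on the output of the first one. -/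
def bind : QProg Q w α → (α → QProg Q w β) → QProg Q w β
  | ret a, k => fresh (k a)
  | gate U next, k => gate U (next.bind k)
  | query q c next, k => query q c (next.bind k)
  | meas f next, k => meas f fun o => (next o).bind k
  | fresh next, k => fresh (next.bind k)

/-- The worst-case cost of a program, over all measurement outcomes, when each call to the
black-box operator `q` (controlled or not) costs `cost q`. -/
def queries (cost : Q → ℕ) : QProg Q w α → ℕ
  | ret _ => 0
  | gate _ next => next.queries cost
  | query q _ next => cost q + next.queries cost
  | meas _ next => Finset.univ.sup fun o => (next o).queries cost
  | fresh next => next.queries cost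

section semantics

variable {H : Type} [NormedAddCommGroup H] [InnerProductSpace ℂ H]

open Classical in
/-- `prob O E p v` is the probability that the program `p`, started in the joint state
`∑ i, v i ⊗ |i⟩` of data register and workspace, halts with an output `a` and a
(non-normalised) final joint state `u` such that `E a u`.  The black-box operator `q` acts on the
data register as `O q`.  Measurement branches carry non-normalised states, the squared norm of the
state being the probability of the branch; the workspace that is replaced in a step `fresh` is
traced out by measuring it in the computational basis. -/
def prob (O : Q → H → H) (E : α → (Fin (w + 1) → H) → Prop) :
    QProg Q w α → (Fin (w + 1) → H) → ℝ
  | ret a, v => if E a v then ∑ i, ‖v i‖ ^ 2 else 0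
  | gate U next, v => next.prob O E fun i => ∑ j, (U : Matrix _ _ ℂ) i j • v j
  | query q c next, v => next.prob O E fun i => if c i then O q (v i) else v i
  | meas f next, v => ∑ o, (next o).prob O E fun i => if f i = o then v i else 0
  | fresh next, v => ∑ i, next.prob O E (Pi.single 0 (v i))

/-- The probability of the event `E` when the program is started on one copy of the state `ψ`
with workspace `|0⟩`. -/
def probFrom (p : QProg Q w α) (O : Q → H → H) (ψ : H)
    (E : α → (Fin (w + 1) → H) → Prop) : ℝ :=
  p.prob O E (Pi.single 0 ψ)

/-- The data register is in the state `ψ`, up to the normalisation and the phase: the joint state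
is the product of `ψ` and a vector of the workspace. -/
def Restored (ψ : H) (u : Fin (w + 1) → H) : Prop :=
  ∃ c : Fin (w + 1) → ℂ, ∀ i, u i = c i • ψ

end semantics

end QProg

/-- The reflection `1 - 2 |ψ⟩⟨ψ|`. -/
def reflState {H : Type} [NormedAddCommGroup H] [InnerProductSpace ℂ H] (ψ : H) (v : H) : H :=
  v - (2 : ℂ) • inner ℂ ψ v • ψ

/-- The reflection `1 - 2 T`. -/
def reflProj {H : Type} [NormedAddCommGroup H] [InnerProductSpace ℂ H] (T : H →ₗ[ℂ] H) (v : H) :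
    H :=
  v - (2 : ℂ) • T v

/-! ## Nondestructive amplitude estimation -/

/-- The two black boxes of amplitude estimation. -/
inductive AEQuery : Type
  | state
  | proj

/-- `state` is the reflection through the state `ψ`, `proj` the reflection through the image of
the projection `T`. -/
def aeOracle {H : Type} [NormedAddCommGroup H] [InnerProductSpace ℂ H] (ψ : H) (T : H →ₗ[ℂ] H) :
    AEQuery → H → H
  | .state => reflState ψ
  | .proj => reflProj T

/-- The program `N` is a nondestructive amplitude estimation algorithm with time parameter `t` and
failure parameter `δ`.  On one copy of any unit vector `ψ` of any Hilbert space, and for any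
orthogonal projection `T`, it outputs an estimate in `[0,1]` of `p = ‖T ψ‖ ^ 2`, it restores `ψ`
with probability at least `1 - δ`, and it calls the two reflections at most `C t log (1/δ)`
times. -/
structure IsNondestructiveAE (C t δ : ℝ) {w : ℕ} (N : QProg AEQuery w ℝ) : Prop where
  range : ∀ (H : Type) [NormedAddCommGroup H] [InnerProductSpace ℂ H] (ψ : H) (T : H →ₗ[ℂ] H),
    ‖ψ‖ = 1 → T.IsSymmetricProjection →
      N.probFrom (aeOracle ψ T) ψ (fun e _ => e ∈ Set.Icc (0 : ℝ) 1) = 1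
  accuracy : ∀ (H : Type) [NormedAddCommGroup H] [InnerProductSpace ℂ H] (ψ : H) (T : H →ₗ[ℂ] H),
    ‖ψ‖ = 1 → T.IsSymmetricProjection →
      1 - δ ≤ N.probFrom (aeOracle ψ T) ψ (fun e _ =>
        |e - ‖T ψ‖ ^ 2| < √(‖T ψ‖ ^ 2 * (1 - ‖T ψ‖ ^ 2)) / t + 1 / t ^ 2)
  zero : ∀ (H : Type) [NormedAddCommGroup H] [InnerProductSpace ℂ H] (ψ : H) (T : H →ₗ[ℂ] H),
    ‖ψ‖ = 1 → T.IsSymmetricProjection → ‖T ψ‖ ^ 2 ≤ 1 / (4 * t ^ 2) →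
      1 - δ ≤ N.probFrom (aeOracle ψ T) ψ (fun e _ => e = 0)
  restores : ∀ (H : Type) [NormedAddCommGroup H] [InnerProductSpace ℂ H] (ψ : H) (T : H →ₗ[ℂ] H),
    ‖ψ‖ = 1 → T.IsSymmetricProjection →
      1 - δ ≤ N.probFrom (aeOracle ψ T) ψ (fun _ u => QProg.Restored ψ u)
  cost : (N.queries (fun _ => 1) : ℝ) ≤ C * (t * Real.log (1 / δ))

/-! ## Qsamples -/

/-- `S` is the support of the finite random variable `X`: the set of values that `X` takes with
positive probability. -/
structure IsFiniteSupport {Ω : Type*} [MeasurableSpace Ω] (P : Measure Ω) (X : Ω → ℝ)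
    (S : Finset ℝ) : Prop where
  ae_mem : ∀ᵐ ω ∂P, X ω ∈ S
  pos : ∀ x ∈ S, P (X ⁻¹' {x}) ≠ 0

/-- The qsample `∑ x, √Pr[X = x] |x⟩`, in the Hilbert space with orthonormal basis indexed by the
support `S`. -/
def qsample {Ω : Type*} [MeasurableSpace Ω] (P : Measure Ω) (X : Ω → ℝ) (S : Finset ℝ) :
    EuclideanSpace ℂ S :=
  WithLp.toLp 2 fun x => ((√(P.real (X ⁻¹' {(x : ℝ)})) : ℝ) : ℂ)

/-- The projection `∑ |x⟩⟨x|`, over the values `x ≥ y` of the support; for the qsample of `X` the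
squared norm of the projected state is `Pr[X ≥ y]`. -/
def tailProj (S : Finset ℝ) (y : ℝ) : EuclideanSpace ℂ S →ₗ[ℂ] EuclideanSpace ℂ S where
  toFun v := WithLp.toLp 2 fun x => if y ≤ (x : ℝ) then v x else 0
  map_add' u v := by ext x; by_cases h : y ≤ (x : ℝ) <;> simp [h]
  map_smul' c v := by ext x; by_cases h : y ≤ (x : ℝ) <;> simp [h]

/-! ## The nondestructive median estimator -/

/-- The operators used by the median estimator: the reflection through the qsample, and, for every
threshold `y`, the reflection through the basis states `|x⟩` with `x ≥ y`, which does not depend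
on the distribution of the random variable. -/
inductive MediQuery : Type
  | qsample
  | tail (y : ℝ)

/-- Interpretation of these operators when the qsample is `ψ`. -/
def mediOracle (S : Finset ℝ) (ψ : EuclideanSpace ℂ S) :
    MediQuery → EuclideanSpace ℂ S → EuclideanSpace ℂ S
  | .qsample => reflState ψ
  | .tail y => reflProj (tailProj S y)

/-- Only the reflections through the qsample are counted. -/
def mediCost : MediQuery → ℕ
  | .qsample => 1
  | .tail _ => 0

/-- Calls of amplitude estimation, for the state `ψ` and the projection onto the values `x ≥ y`. -/
def aeToMedi (y : ℝ) : AEQuery → MediQuery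
  | .state => .qsample
  | .proj => .tail y

/-- `supportValue S k` is the `k`-th smallest element `x_k` of the support
`x_1 < ⋯ < x_n`. -/
def supportValue (S : Finset ℝ) (k : ℕ) : ℝ :=
  (S.sort (· ≤ ·)).getD (k - 1) 0

/-- The binary search: while `a < b`, put `k = ⌊(a + b) / 2⌋`, estimate `Pr[X ≥ x_k]` by running
the program `N`, replace `b` by `k` if the estimate is at most `1/6` and `a` by `k + 1`
otherwise.  Once `a = b`, output `x_{a-1}` (and `x_1` if `a = 1`). -/
def mediSearch {w : ℕ} (N : QProg AEQuery w ℝ) (S : Finset ℝ) (a b : ℕ) :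
    QProg MediQuery w ℝ :=
  if _h : a < b then
    (N.rename (aeToMedi (supportValue S ((a + b) / 2)))).bind fun e =>
      if e ≤ 1 / 6 then mediSearch N S a ((a + b) / 2)
      else mediSearch N S ((a + b) / 2 + 1) b
  else .ret (supportValue S (a - 1))
  termination_by b - a
  decreasing_by all_goals omega

/-- The nondestructive median estimator, for a random variable with support `S`, where `N` is used
for amplitude estimation. -/
def medi {w : ℕ} (N : QProg AEQuery w ℝ) (S : Finset ℝ) : QProg MediQuery w ℝ :=
  mediSearch N S 1 (S.card + 1)

/-- The failure parameter of the amplitude estimations: the total `η` is divided among the at most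
`⌊log₂ n⌋ + 1` rounds of the search, each of which may fail to give a good estimate or to restore
the state. -/
def mediDelta (n : ℕ) (η : ℝ) : ℝ :=
  η / (2 * (Nat.log 2 n + 1 : ℕ))

end

/-!
**Amplitude estimation with a constant time parameter.**  Let `p = ‖T ψ‖ ^ 2`.  On the plane spanned
by `ψ` and `T ψ`, which both reflections preserve, the Grover iterate `U` (the product of the two
reflections) is a rotation with `U + U⁻¹ = 4 p - 2` (`grover_add_groverInv`).  Hence its Hadamard
test, whose Kraus operators are `(1 ± U) / 2`, has outcomes of probabilities `p` and `1 - p` in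
*every* state of the plane, because `(1 + U)† (1 + U) / 4 = p` there.  So `d` Hadamard tests are `d`
independent trials of success probability `p`, and as the time parameter `3 √2` is a constant,
`d = O(log (1 / δ))` of them give the required accuracy by a Chernoff bound
(`sum_prod_krausWeight_tail_le`); no phase estimation is needed.

**Nondestructiveness.**  The tests are made coherently on `d` workspace qubits.  Only the number of
successes is measured, with the smallest numbers all identified with `0` and the largest with `d`,
and the tests are then undone.  If a measured value has probability `W`, then the component of the
workspace state `|0⟩` is afterwards exactly `W ψ` (`sq_le_prob_aeUncompute`).  When `p` is close to
`0` or to `1`, some value has probability at least `1 - δ / 2`, hence the state survives with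
probability at least `(1 - δ / 2) ^ 2 ≥ 1 - δ`. Otherwise `p (1 - p)` is bounded below and the
state may be damaged, but it can be repaired: measure whether the register is in the state `ψ`,
and, if it is not, apply the reflection through `T`, which makes the next measurement succeed with
probability `4 p (1 - p)` (`norm_stateProj_reflProj_sq`); `O(log (1 / δ))` such rounds suffice
(`le_prob_restoreLoop`).

**Median estimation.**  A round of the binary search on accurate estimates keeps the invariant
`Pr[X ≥ x_{a-1}] > 1/18` and `Pr[X ≥ x_b] < 1/3` (`SearchInvariant`), so that the output has more
than `1/18` of the probability on either side, and Chebyshev's inequality bounds its distance to the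
mean.  A round halves the range, so there are at most `⌊log₂ n⌋ + 1` of them; each fails to be
accurate or to restore the qsample with probability at most `2 δ`, and as long as none fails the
next one starts again from one copy of the qsample (`QProg.le_prob_bind`).
-/

/-! ### Probabilities of events of a query program -/

namespace QProg

theorem sum_norm_sq_unitary {H : Type*} [NormedAddCommGroup H] [InnerProductSpace ℂ H]
    {ι : Type*} [Fintype ι] [DecidableEq ι] {U : Matrix ι ι ℂ}
    (hU : U ∈ Matrix.unitaryGroup ι ℂ) (v : ι → H) :
    ∑ i, ‖∑ j, U i j • v j‖ ^ 2 = ∑ i, ‖v i‖ ^ 2 := by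
  have hU : ∀ j k, ∑ i, star (U i j) * U i k = if j = k then 1 else 0 := by
    intro j k
    have := congrFun (congrFun (Matrix.mem_unitaryGroup_iff'.1 hU) j) k
    simpa [Matrix.mul_apply, Matrix.star_apply, Matrix.one_apply] using this
  have key : ∑ i, inner ℂ (∑ j, U i j • v j) (∑ j, U i j • v j) = ∑ j, inner ℂ (v j) (v j) := by
    calc _ = ∑ i, ∑ j, ∑ k, star (U i j) * U i k * inner ℂ (v j) (v k) := by
          refine Finset.sum_congr rfl fun i _ => ?_
          rw [sum_inner]
          refine Finset.sum_congr rfl fun j _ => ?_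
          rw [inner_sum]
          refine Finset.sum_congr rfl fun k _ => ?_
          rw [inner_smul_left, inner_smul_right, ← mul_assoc]
          rfl
      _ = ∑ j, ∑ k, (∑ i, star (U i j) * U i k) * inner ℂ (v j) (v k) := by
          rw [Finset.sum_comm]
          refine Finset.sum_congr rfl fun j _ => ?_
          rw [Finset.sum_comm]
          exact Finset.sum_congr rfl fun k _ => (Finset.sum_mul _ _ _).symm
      _ = _ := by
          simp only [hU, ite_mul, one_mul, zero_mul, Finset.sum_ite_eq, Finset.mem_univ, if_true]
  simp only [inner_self_eq_norm_sq_to_K] at key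
  exact_mod_cast key

/-- The probabilities of the outcomes of a partial measurement add up. -/
theorem sum_norm_sq_meas {H : Type*} [NormedAddCommGroup H] {w : ℕ}
    (f : Fin (w + 1) → Fin (w + 1)) (v : Fin (w + 1) → H) :
    ∑ o, ∑ i, ‖if f i = o then v i else 0‖ ^ 2 = ∑ i, ‖v i‖ ^ 2 := by
  rw [Finset.sum_comm]
  refine Finset.sum_congr rfl fun i _ => ?_
  rw [Finset.sum_eq_single (f i)] <;> simp +contextual [eq_comm]

theorem sum_norm_sq_single {H : Type*} [NormedAddCommGroup H] {w : ℕ}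
    (i : Fin (w + 1)) (x : H) :
    ∑ j, ‖(Pi.single i x : Fin (w + 1) → H) j‖ ^ 2 = ‖x‖ ^ 2 := by
  rw [Finset.sum_eq_single i] <;> simp +contextual

variable {Q Q' : Type} {w : ℕ} {α β : Type}
variable {H : Type} [NormedAddCommGroup H] [InnerProductSpace ℂ H]

theorem prob_nonneg (O : Q → H → H) (E : α → (Fin (w + 1) → H) → Prop) (p : QProg Q w α)
    (v : Fin (w + 1) → H) : 0 ≤ p.prob O E v := by
  induction p generalizing v with
  | ret a => simp only [prob]; split_ifs <;> positivity
  | gate U next ih => exact ih _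
  | query q c next ih => exact ih _
  | meas f next ih => exact Finset.sum_nonneg fun o _ => ih o _
  | fresh next ih => exact Finset.sum_nonneg fun o _ => ih _

theorem prob_mono (O : Q → H → H) {E E' : α → (Fin (w + 1) → H) → Prop}
    (h : ∀ a u, E a u → E' a u) (p : QProg Q w α)
    (v : Fin (w + 1) → H) : p.prob O E v ≤ p.prob O E' v := by
  induction p generalizing v with
  | ret a =>
    simp only [prob]
    split_ifs with h1 h2
    · exact le_rfl
    · exact absurd (h _ _ h1) h2
    · positivity
    · exact le_rfl
  | gate U next ih => exact ih _
  | query q c next ih => exact ih _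
  | meas f next ih => exact Finset.sum_le_sum fun o _ => ih o _
  | fresh next ih => exact Finset.sum_le_sum fun o _ => ih _

/-- The union bound, in the form of a lower bound on the probability of two events. -/
theorem prob_add_le_prob_and (O : Q → H → H) (E E' : α → (Fin (w + 1) → H) → Prop)
    (p : QProg Q w α) (v : Fin (w + 1) → H) :
    p.prob O E v + p.prob O E' v
      ≤ p.prob O (fun a u => E a u ∧ E' a u) v + p.prob O (fun _ _ => True) v := by
  induction p generalizing v with
  | ret a =>
    have : (0 : ℝ) ≤ ∑ i, ‖v i‖ ^ 2 := by positivity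
    by_cases h1 : E a v <;> by_cases h2 : E' a v <;> simp [prob, h1, h2, this]
  | gate U next ih => exact ih _
  | query q c next ih => exact ih _
  | meas f next ih =>
    simp only [prob, ← Finset.sum_add_distrib]
    exact Finset.sum_le_sum fun o _ => ih o _
  | fresh next ih =>
    simp only [prob, ← Finset.sum_add_distrib]
    exact Finset.sum_le_sum fun o _ => ih _

theorem prob_true {O : Q → H → H} (hO : ∀ q x, ‖O q x‖ = ‖x‖) (p : QProg Q w α)
    (v : Fin (w + 1) → H) : p.prob O (fun _ _ => True) v = ∑ i, ‖v i‖ ^ 2 := by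
  induction p generalizing v with
  | ret a => simp [prob]
  | gate U next ih => simp only [prob, ih]; exact sum_norm_sq_unitary U.2 v
  | query q c next ih =>
    simp only [prob, ih]
    refine Finset.sum_congr rfl fun i _ => ?_
    split_ifs
    · rw [hO]
    · rfl
  | meas f next ih => simp only [prob, ih]; exact sum_norm_sq_meas f v
  | fresh next ih => 
    simp only [prob, ih]
    exact Finset.sum_congr rfl fun i _ => sum_norm_sq_single 0 (v i)

theorem prob_le {O : Q → H → H} (hO : ∀ q x, ‖O q x‖ = ‖x‖)
    (E : α → (Fin (w + 1) → H) → Prop) (p : QProg Q w α)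
    (v : Fin (w + 1) → H) : p.prob O E v ≤ ∑ i, ‖v i‖ ^ 2 :=
  (prob_mono O (fun _ _ _ => trivial) p v).trans_eq (prob_true hO p v)

theorem prob_zero {O : Q → H → H} (hO : ∀ q x, ‖O q x‖ = ‖x‖)
    (E : α → (Fin (w + 1) → H) → Prop) (p : QProg Q w α) {v : Fin (w + 1) → H} (hv : v = 0) :
    p.prob O E v = 0 :=
  le_antisymm ((prob_le hO E p v).trans_eq (by simp [hv])) (prob_nonneg O E p v)

theorem prob_false (O : Q → H → H) (p : QProg Q w α) (v : Fin (w + 1) → H) :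
    p.prob O (fun _ _ => False) v = 0 := by
  induction p generalizing v with
  | ret a => simp [prob]
  | gate U next ih => exact ih _
  | query q c next ih => exact ih _
  | meas f next ih => exact Finset.sum_eq_zero fun o _ => ih o _
  | fresh next ih => exact Finset.sum_eq_zero fun o _ => ih _

/-- Homogeneity: rescaling the initial state rescales all probabilities, for an event that does not
depend on the normalisation. -/
theorem prob_smul {O : Q → H → H} (hO : ∀ q x, ‖O q x‖ = ‖x‖)
    (hs : ∀ q (c : ℂ) x, O q (c • x) = c • O q x)
    {E : α → (Fin (w + 1) → H) → Prop} (hE : ∀ a (c : ℂ) u, c ≠ 0 → (E a (c • u) ↔ E a u))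
    (p : QProg Q w α) (c : ℂ) (v : Fin (w + 1) → H) :
    p.prob O E (c • v) = ‖c‖ ^ 2 * p.prob O E v := by
  rcases eq_or_ne c 0 with rfl | hc
  · rw [prob_zero hO E p (zero_smul _ _)]; simp
  induction p generalizing v with
  | ret a =>
    have := hE a c v hc
    by_cases h : E a v <;>
      simp [prob, this, h, norm_smul, mul_pow, Finset.mul_sum]
  | gate U next ih =>
    simp only [prob]
    rw [← ih]
    congr 1
    funext i
    simp only [Pi.smul_apply, Finset.smul_sum, smul_comm c]
  | query q ctrl next ih =>
    simp only [prob]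
    rw [← ih]
    congr 1
    funext i
    simp only [Pi.smul_apply]
    split_ifs <;> simp [hs]
  | meas f next ih =>
    simp only [prob, Finset.mul_sum]
    refine Finset.sum_congr rfl fun o _ => ?_
    rw [← ih]
    congr 1
    funext i
    simp only [Pi.smul_apply]
    split_ifs <;> simp
  | fresh next ih =>
    simp only [prob, Finset.mul_sum]
    refine Finset.sum_congr rfl fun o _ => ?_
    rw [← ih]
    congr 1
    rw [← Pi.single_smul]; rfl

theorem prob_rename (g : Q → Q') (O : Q' → H → H) (E : α → (Fin (w + 1) → H) → Prop)
    (p : QProg Q w α) (v : Fin (w + 1) → H) :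
    (p.rename g).prob O E v = p.prob (fun q => O (g q)) E v := by
  induction p generalizing v with
  | ret a => rfl
  | gate U next ih => exact ih _
  | query q c next ih => exact ih _
  | meas f next ih => exact Finset.sum_congr rfl fun o _ => ih o _
  | fresh next ih => exact Finset.sum_congr rfl fun o _ => ih _

theorem queries_rename (g : Q → Q') (cost : Q' → ℕ) (p : QProg Q w α) :
    (p.rename g).queries cost = p.queries fun q => cost (g q) := by
  induction p with
  | ret a => rfl
  | gate U next ih => exact ih
  | query q c next ih => simp only [rename, queries, ih]
  | meas f next ih => exact Finset.sup_congr rfl fun o _ => ih o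
  | fresh next ih => exact ih

theorem queries_mono {cost cost' : Q → ℕ} (h : ∀ q, cost q ≤ cost' q) (p : QProg Q w α) :
    p.queries cost ≤ p.queries cost' := by
  induction p with
  | ret a => exact le_rfl
  | gate U next ih => exact ih
  | query q c next ih => exact add_le_add (h q) ih
  | meas f next ih => exact Finset.sup_mono_fun fun o _ => ih o
  | fresh next ih => exact ih

theorem queries_bind_le (cost : Q → ℕ) (p : QProg Q w α) (k : α → QProg Q w β) {m : ℕ}
    (hk : ∀ a, (k a).queries cost ≤ m) :
    (p.bind k).queries cost ≤ p.queries cost + m := by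
  induction p with
  | ret a => simpa [bind, queries] using hk a
  | gate U next ih => exact ih
  | query q c next ih => simp only [bind, queries]; omega
  | meas f next ih =>
    refine Finset.sup_le fun o _ => (ih o).trans ?_
    gcongr
    exact Finset.le_sup (f := fun o => (next o).queries cost) (Finset.mem_univ o)
  | fresh next ih => exact ih

/-- Sequential composition: if the first program leaves the data register in the state `ψ` and
outputs a value satisfying `G`, and for such values the second one, started on `ψ`, achieves the
event `E` with probability at least `c`, then the probabilities multiply. -/
theorem le_prob_bind {O : Q → H → H} (hO : ∀ q x, ‖O q x‖ = ‖x‖)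
    (hs : ∀ q (c : ℂ) x, O q (c • x) = c • O q x)
    {E : β → (Fin (w + 1) → H) → Prop} (hE : ∀ a (c : ℂ) u, c ≠ 0 → (E a (c • u) ↔ E a u))
    {ψ : H} (hψ : ‖ψ‖ = 1) {G : α → Prop} {k : α → QProg Q w β} {c : ℝ}
    (hk : ∀ a, G a → c ≤ (k a).probFrom O ψ E) (p : QProg Q w α) (v : Fin (w + 1) → H) :
    p.prob O (fun a u => G a ∧ Restored ψ u) v * c ≤ (p.bind k).prob O E v := by
  induction p generalizing v with
  | ret a =>
    simp only [prob, bind]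
    split_ifs with h
    · obtain ⟨hG, z, hz⟩ := h
      rw [Finset.sum_mul]
      refine Finset.sum_le_sum fun i _ => ?_
      have : (Pi.single 0 (v i) : Fin (w + 1) → H) = z i • Pi.single 0 ψ := by
        rw [hz, ← Pi.single_smul]
      rw [this, prob_smul hO hs hE, hz, norm_smul, hψ, mul_one]
      exact mul_le_mul_of_nonneg_left (hk a hG) (by positivity)
    · rw [zero_mul]
      exact Finset.sum_nonneg fun i _ => prob_nonneg O E _ _
  | gate U next ih => exact ih _
  | query q c next ih => exact ih _
  | meas f next ih =>
    simp only [prob, bind, Finset.sum_mul]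
    exact Finset.sum_le_sum fun o _ => ih o _
  | fresh next ih =>
    simp only [prob, bind, Finset.sum_mul]
    exact Finset.sum_le_sum fun o _ => ih _

theorem restored_smul_iff (ψ : H) {c : ℂ} (hc : c ≠ 0) (u : Fin (w + 1) → H) :
    Restored ψ (c • u) ↔ Restored ψ u := by
  constructor
  · rintro ⟨z, hz⟩
    refine ⟨fun i => c⁻¹ * z i, fun i => ?_⟩
    rw [mul_smul, ← hz i, Pi.smul_apply, smul_smul, inv_mul_cancel₀ hc, one_smul]
  · rintro ⟨z, hz⟩
    exact ⟨fun i => c * z i, fun i => by rw [mul_smul, ← hz i, Pi.smul_apply]⟩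

end QProg

/-! ### The plane spanned by a state and its projection -/

section Geometry

variable {H : Type} [NormedAddCommGroup H] [InnerProductSpace ℂ H]

theorem reflProj_smul (T : H →ₗ[ℂ] H) (c : ℂ) (v : H) :
    reflProj T (c • v) = c • reflProj T v := by
  simp only [reflProj, map_smul, smul_sub, smul_comm c]

theorem reflProj_reflProj {T : H →ₗ[ℂ] H} (hT : T.IsSymmetricProjection) (v : H) :
    reflProj T (reflProj T v) = v := by
  have : T (T v) = T v := congrArg (fun S : H →ₗ[ℂ] H => S v) hT.isIdempotentElem.eq
  simp only [reflProj, map_sub, map_smul, this]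
  module

theorem inner_reflProj {T : H →ₗ[ℂ] H} (hT : T.IsSymmetricProjection) (v u : H) :
    inner ℂ (reflProj T v) u = inner ℂ v (reflProj T u) := by
  simp only [reflProj, inner_sub_left, inner_sub_right, inner_smul_left, inner_smul_right,
    hT.isSymmetric v u, map_ofNat]

theorem inner_self_eq_ofReal (v : H) : inner ℂ v v = ((‖v‖ ^ 2 : ℝ) : ℂ) := by
  rw [inner_self_eq_norm_sq_to_K]
  simp

theorem norm_reflProj {T : H →ₗ[ℂ] H} (hT : T.IsSymmetricProjection) (v : H) :
    ‖reflProj T v‖ = ‖v‖ := by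
  have : inner ℂ (reflProj T v) (reflProj T v) = inner ℂ v v := by
    rw [inner_reflProj hT, reflProj_reflProj hT]
  simp only [inner_self_eq_ofReal] at this
  have h2 : ‖reflProj T v‖ ^ 2 = ‖v‖ ^ 2 := by exact_mod_cast this
  exact (sq_eq_sq₀ (norm_nonneg _) (norm_nonneg _)).1 h2

/-- The projection onto the line of a state, so that the reflection through the state is an
instance of the reflection through a projection. -/
noncomputable def stateProj (ψ : H) : H →ₗ[ℂ] H := (InnerProductSpace.rankOne ℂ ψ ψ).toLinearMap

theorem stateProj_apply (ψ v : H) : stateProj ψ v = inner ℂ ψ v • ψ := by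
  simp [stateProj]

theorem reflState_eq_reflProj (ψ : H) : reflState ψ = reflProj (stateProj ψ) := by
  funext v
  simp [reflState, reflProj, stateProj_apply]

theorem stateProj_isSymmetricProjection {ψ : H} (hψ : ‖ψ‖ = 1) :
    (stateProj ψ).IsSymmetricProjection where
  isIdempotentElem := by
    ext v
    simp [stateProj_apply, hψ]
  isSymmetric u v := by
    simp [stateProj_apply, inner_smul_left, inner_smul_right, mul_comm]

theorem norm_aeOracle {ψ : H} (hψ : ‖ψ‖ = 1) {T : H →ₗ[ℂ] H} (hT : T.IsSymmetricProjection)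
    (q : AEQuery) (v : H) : ‖aeOracle ψ T q v‖ = ‖v‖ := by
  cases q
  · simp only [aeOracle, reflState_eq_reflProj]
    exact norm_reflProj (stateProj_isSymmetricProjection hψ) v
  · exact norm_reflProj hT v

theorem aeOracle_smul (ψ : H) (T : H →ₗ[ℂ] H) (q : AEQuery) (c : ℂ) (v : H) :
    aeOracle ψ T q (c • v) = c • aeOracle ψ T q v := by
  cases q
  · simp only [aeOracle, reflState_eq_reflProj, reflProj_smul]
  · exact reflProj_smul T c v

/-- The plane (or line) spanned by `ψ` and `T ψ`: the data register never leaves it. -/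
def aePlane (ψ : H) (T : H →ₗ[ℂ] H) : Submodule ℂ H := Submodule.span ℂ {ψ, T ψ}

/-- The Grover iterate: the reflection through `T` followed by the reflection through `ψ`. -/
noncomputable def grover (ψ : H) (T : H →ₗ[ℂ] H) : Module.End ℂ H :=
  (1 - (2 : ℂ) • stateProj ψ) * (1 - (2 : ℂ) • T)

/-- The inverse of the Grover iterate. -/
noncomputable def groverInv (ψ : H) (T : H →ₗ[ℂ] H) : Module.End ℂ H :=
  (1 - (2 : ℂ) • T) * (1 - (2 : ℂ) • stateProj ψ)

theorem grover_apply (ψ : H) (T : H →ₗ[ℂ] H) (v : H) :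
    grover ψ T v = reflState ψ (reflProj T v) := by
  simp [grover, reflState_eq_reflProj, reflProj]

theorem groverInv_apply (ψ : H) (T : H →ₗ[ℂ] H) (v : H) :
    groverInv ψ T v = reflProj T (reflState ψ v) := by
  simp [groverInv, reflState_eq_reflProj, reflProj]

variable {ψ : H} {T : H →ₗ[ℂ] H}

theorem inner_state_proj (hT : T.IsSymmetricProjection) (ψ : H) :
    inner ℂ ψ (T ψ) = ((‖T ψ‖ ^ 2 : ℝ) : ℂ) := by
  have : T (T ψ) = T ψ := congrArg (fun S : H →ₗ[ℂ] H => S ψ) hT.isIdempotentElem.eq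
  rw [← this, ← hT.isSymmetric, this, inner_self_eq_ofReal]

theorem norm_proj_sq_le_one (hψ : ‖ψ‖ = 1) (hT : T.IsSymmetricProjection) :
    ‖T ψ‖ ^ 2 ≤ 1 := by
  have h := norm_inner_le_norm (𝕜 := ℂ) ψ (T ψ)
  rw [inner_state_proj hT, hψ, one_mul] at h
  simp only [Complex.norm_real, norm_pow, norm_norm] at h
  nlinarith [norm_nonneg (T ψ)]

theorem mem_aePlane {v : H} : v ∈ aePlane ψ T ↔ ∃ a b : ℂ, a • ψ + b • T ψ = v :=
  Submodule.mem_span_pair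

theorem state_mem_aePlane : ψ ∈ aePlane ψ T := Submodule.subset_span (by simp)

theorem reflProj_mem_aePlane (hT : T.IsSymmetricProjection) {v : H} (hv : v ∈ aePlane ψ T) :
    reflProj T v ∈ aePlane ψ T := by
  obtain ⟨a, b, rfl⟩ := mem_aePlane.1 hv
  have : T (T ψ) = T ψ := congrArg (fun S : H →ₗ[ℂ] H => S ψ) hT.isIdempotentElem.eq
  refine mem_aePlane.2 ⟨a, -2 * a - b, ?_⟩
  simp only [reflProj, map_add, map_smul, this]
  module

theorem stateProj_mem_aePlane (v : H) : stateProj ψ v ∈ aePlane ψ T := by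
  rw [stateProj_apply]
  exact Submodule.smul_mem _ _ state_mem_aePlane

theorem reflState_mem_aePlane {v : H} (hv : v ∈ aePlane ψ T) : reflState ψ v ∈ aePlane ψ T := by
  rw [reflState_eq_reflProj]
  exact Submodule.sub_mem _ hv (Submodule.smul_mem _ _ (stateProj_mem_aePlane v))

theorem grover_mem_aePlane (hT : T.IsSymmetricProjection) {v : H} (hv : v ∈ aePlane ψ T) :
    grover ψ T v ∈ aePlane ψ T := by
  rw [grover_apply]
  exact reflState_mem_aePlane (reflProj_mem_aePlane hT hv)

theorem groverInv_grover (hψ : ‖ψ‖ = 1) (hT : T.IsSymmetricProjection) (v : H) :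
    groverInv ψ T (grover ψ T v) = v := by
  rw [grover_apply, groverInv_apply, reflState_eq_reflProj,
    reflProj_reflProj (stateProj_isSymmetricProjection hψ), reflProj_reflProj hT]

/-- On the plane the Grover iterate is a rotation, whose angle is given by `‖T ψ‖ ^ 2`. -/
theorem grover_add_groverInv (hψ : ‖ψ‖ = 1) (hT : T.IsSymmetricProjection) {v : H}
    (hv : v ∈ aePlane ψ T) :
    grover ψ T v + groverInv ψ T v = ((4 * ‖T ψ‖ ^ 2 - 2 : ℝ) : ℂ) • v := by
  obtain ⟨a, b, rfl⟩ := mem_aePlane.1 hv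
  have h1 : T (T ψ) = T ψ := congrArg (fun S : H →ₗ[ℂ] H => S ψ) hT.isIdempotentElem.eq
  have h2 : inner ℂ ψ ψ = 1 := by simp [hψ]
  rw [grover_apply, groverInv_apply]
  simp only [reflState, reflProj, map_add, map_sub, map_smul, h1, inner_add_right, inner_sub_right,
    inner_smul_right, inner_state_proj hT, h2]
  push_cast
  module

theorem inner_grover (hψ : ‖ψ‖ = 1) (hT : T.IsSymmetricProjection) (u v : H) :
    inner ℂ (grover ψ T u) v = inner ℂ u (groverInv ψ T v) := by
  rw [grover_apply, groverInv_apply, reflState_eq_reflProj,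
    inner_reflProj (stateProj_isSymmetricProjection hψ), inner_reflProj hT]

/-! ### The Kraus operators of a Hadamard test -/

open Polynomial

/-- The polynomials `(1 ± X) / 2`.  Evaluated at a unitary `U` they are the operators that a
Hadamard test of `U` applies to the data register when its outcome is `b`. -/
noncomputable def krausPoly (b : Bool) : ℂ[X] := C (1 / 2) * (1 + (if b then -1 else 1) * X)

/-- The probability of the outcome `b` of a Hadamard test of the Grover iterate, in terms of
`p = ‖T ψ‖ ^ 2`. -/
def krausWeight (p : ℝ) (b : Bool) : ℝ := if b then 1 - p else p

theorem aeval_krausPoly (U : Module.End ℂ H) (b : Bool) (v : H) :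
    aeval U (krausPoly b) v = (1 / 2 : ℂ) • (v + (if b then (-1 : ℂ) else 1) • U v) := by
  cases b <;> simp [krausPoly, Algebra.algebraMap_eq_smul_one]

theorem aeval_krausPoly_mem (hT : T.IsSymmetricProjection) {v : H} (hv : v ∈ aePlane ψ T)
    (b : Bool) : aeval (grover ψ T) (krausPoly b) v ∈ aePlane ψ T := by
  rw [aeval_krausPoly]
  exact Submodule.smul_mem _ _
    (Submodule.add_mem _ hv (Submodule.smul_mem _ _ (grover_mem_aePlane hT hv)))

/-- The product of a Kraus operator of the Hadamard test with its adjoint is a scalar on the plane: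
the outcome has the same probability in all states, and it can be undone. -/
theorem aeval_groverInv_aeval_grover (hψ : ‖ψ‖ = 1) (hT : T.IsSymmetricProjection) {v : H}
    (hv : v ∈ aePlane ψ T) (b : Bool) :
    aeval (groverInv ψ T) (krausPoly b) (aeval (grover ψ T) (krausPoly b) v) =
      ((krausWeight (‖T ψ‖ ^ 2) b : ℝ) : ℂ) • v := by
  have h := grover_add_groverInv hψ hT hv
  have h' : grover ψ T v = ((4 * ‖T ψ‖ ^ 2 - 2 : ℝ) : ℂ) • v - groverInv ψ T v := by
    rw [← h]; abel
  simp only [aeval_krausPoly, map_smul, map_add, groverInv_grover hψ hT]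
  rw [h']
  cases b <;> simp [krausWeight] <;> module

theorem inner_aeval_grover (hψ : ‖ψ‖ = 1) (hT : T.IsSymmetricProjection) (u v : H) (b : Bool) :
    inner ℂ (aeval (grover ψ T) (krausPoly b) u) v =
      inner ℂ u (aeval (groverInv ψ T) (krausPoly b) v) := by
  simp only [aeval_krausPoly, inner_smul_left, inner_smul_right, inner_add_left, inner_add_right,
    inner_grover hψ hT]
  cases b <;> simp [map_ofNat]

theorem norm_aeval_grover_sq (hψ : ‖ψ‖ = 1) (hT : T.IsSymmetricProjection) {v : H}
    (hv : v ∈ aePlane ψ T) (b : Bool) :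
    ‖aeval (grover ψ T) (krausPoly b) v‖ ^ 2 = krausWeight (‖T ψ‖ ^ 2) b * ‖v‖ ^ 2 := by
  have h : inner ℂ (aeval (grover ψ T) (krausPoly b) v) (aeval (grover ψ T) (krausPoly b) v) =
      ((krausWeight (‖T ψ‖ ^ 2) b : ℝ) : ℂ) * inner ℂ v v := by
    rw [inner_aeval_grover hψ hT, aeval_groverInv_aeval_grover hψ hT hv, inner_smul_right]
  simp only [inner_self_eq_ofReal] at h
  exact_mod_cast h

theorem aeval_prod_krausPoly_mem (hT : T.IsSymmetricProjection) {ι : Type*} (s : Finset ι)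
    (y : ι → Bool) {v : H} (hv : v ∈ aePlane ψ T) :
    aeval (grover ψ T) (∏ j ∈ s, krausPoly (y j)) v ∈ aePlane ψ T := by
  induction s using Finset.cons_induction with
  | empty => simpa using hv
  | cons i s hi ih =>
    rw [Finset.prod_cons, map_mul, Module.End.mul_apply]
    exact aeval_krausPoly_mem hT ih _

theorem norm_aeval_prod_krausPoly_sq (hψ : ‖ψ‖ = 1) (hT : T.IsSymmetricProjection) {ι : Type*}
    (s : Finset ι) (y : ι → Bool) {v : H} (hv : v ∈ aePlane ψ T) :
    ‖aeval (grover ψ T) (∏ j ∈ s, krausPoly (y j)) v‖ ^ 2 =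
      (∏ j ∈ s, krausWeight (‖T ψ‖ ^ 2) (y j)) * ‖v‖ ^ 2 := by
  induction s using Finset.cons_induction with
  | empty => simp
  | cons i s hi ih =>
    rw [Finset.prod_cons, map_mul, Module.End.mul_apply,
      norm_aeval_grover_sq hψ hT (aeval_prod_krausPoly_mem hT s y hv), ih, Finset.prod_cons,
      mul_assoc]

theorem aeval_groverInv_prod_aeval_grover_prod (hψ : ‖ψ‖ = 1) (hT : T.IsSymmetricProjection)
    {ι : Type*} (s : Finset ι) (y : ι → Bool) {v : H} (hv : v ∈ aePlane ψ T) :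
    aeval (groverInv ψ T) (∏ j ∈ s, krausPoly (y j))
        (aeval (grover ψ T) (∏ j ∈ s, krausPoly (y j)) v) =
      ((∏ j ∈ s, krausWeight (‖T ψ‖ ^ 2) (y j) : ℝ) : ℂ) • v := by
  induction s using Finset.cons_induction with
  | empty => simp
  | cons i s hi ih =>
    rw [Finset.prod_cons, map_mul (aeval (grover ψ T)), Module.End.mul_apply, mul_comm, map_mul,
      Module.End.mul_apply,
      aeval_groverInv_aeval_grover hψ hT (aeval_prod_krausPoly_mem hT s y hv), map_smul, ih,
      smul_smul, Finset.prod_cons]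
    push_cast
    rfl

/-- From the part of the plane orthogonal to `ψ`, the reflection through `T` leads back to `ψ` with
probability `4 p (1 - p)`, where `p = ‖T ψ‖ ^ 2`. -/
theorem norm_stateProj_reflProj_sq (hψ : ‖ψ‖ = 1) (hT : T.IsSymmetricProjection) {v : H}
    (hv : v ∈ aePlane ψ T) :
    ‖stateProj ψ (reflProj T (v - stateProj ψ v))‖ ^ 2 =
      4 * ‖T ψ‖ ^ 2 * (1 - ‖T ψ‖ ^ 2) * ‖v - stateProj ψ v‖ ^ 2 := by
  obtain ⟨a, b, rfl⟩ := mem_aePlane.1 hv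
  have h1 : T (T ψ) = T ψ := congrArg (fun S : H →ₗ[ℂ] H => S ψ) hT.isIdempotentElem.eq
  have h2 : inner ℂ ψ ψ = 1 := by simp [hψ]
  set p : ℝ := ‖T ψ‖ ^ 2 with hp
  have h3 : inner ℂ ψ (T ψ) = (p : ℂ) := inner_state_proj hT ψ
  have h4 : inner ℂ (T ψ) ψ = (p : ℂ) := by rw [hT.isSymmetric]; exact h3
  have h5 : inner ℂ (T ψ) (T ψ) = (p : ℂ) := by rw [hT.isSymmetric, h1]; exact h3
  have e1 : a • ψ + b • T ψ - stateProj ψ (a • ψ + b • T ψ) = b • (T ψ - (p : ℂ) • ψ) := by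
    simp only [stateProj_apply, inner_add_right, inner_smul_right, h2, h3]
    module
  have e2 : stateProj ψ (reflProj T (b • (T ψ - (p : ℂ) • ψ))) =
      (-2 * b * (p - p ^ 2) : ℂ) • ψ := by
    simp only [stateProj_apply, reflProj, map_sub, map_smul, h1, h2, h3]
    module
  have e3 : ‖T ψ - (p : ℂ) • ψ‖ ^ 2 = p * (1 - p) := by
    have : inner ℂ (T ψ - (p : ℂ) • ψ) (T ψ - (p : ℂ) • ψ) = (p * (1 - p) : ℂ) := by
      simp only [inner_sub_left, inner_sub_right, inner_smul_left, inner_smul_right, h2, h3, h4,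
        h5, Complex.conj_ofReal]
      ring
    rw [inner_self_eq_ofReal] at this
    exact_mod_cast this
  have e4 : ‖(-2 * b * (p - p ^ 2) : ℂ)‖ ^ 2 = 4 * ‖b‖ ^ 2 * (p - p ^ 2) ^ 2 := by
    have : (p - p ^ 2 : ℂ) = ((p - p ^ 2 : ℝ) : ℂ) := by push_cast; rfl
    rw [this, norm_mul, norm_mul, Complex.norm_real]
    simp only [mul_pow, norm_neg, Complex.norm_ofNat, Real.norm_eq_abs, sq_abs]
    ring
  rw [e1, e2, norm_smul, norm_smul, hψ, mul_one, e4, mul_pow, e3]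
  ring

theorem norm_sub_stateProj_sq (hψ : ‖ψ‖ = 1) (v : H) :
    ‖v - stateProj ψ v‖ ^ 2 = ‖v‖ ^ 2 - ‖stateProj ψ v‖ ^ 2 := by
  have h0 : inner ℂ (v - stateProj ψ v) (stateProj ψ v) = 0 := by
    have hP := stateProj_isSymmetricProjection hψ
    have h1 : stateProj ψ (stateProj ψ v) = stateProj ψ v :=
      congrArg (fun S : H →ₗ[ℂ] H => S v) hP.isIdempotentElem.eq
    rw [← hP.isSymmetric, map_sub, h1, sub_self, inner_zero_left]
  have := norm_add_sq_eq_norm_sq_add_norm_sq_of_inner_eq_zero _ _ h0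
  rw [sub_add_cancel] at this
  nlinarith

end Geometry

/-! ### Hadamard tests on a workspace of qubits -/

section Hadamard

open Polynomial

variable {d w : ℕ}

/-- `√2` times an entry of the Hadamard gate. -/
def hadamardSign (x y : Bool) : ℂ := if x && y then -1 else 1

/-- The Hadamard gate on all qubits of a workspace whose basis states are identified by `ε` with
strings of `d` bits. -/
noncomputable def hadamard (ε : Fin (w + 1) ≃ (Fin d → Bool)) :
    Matrix (Fin (w + 1)) (Fin (w + 1)) ℂ :=
  fun i j => ∏ k, (((√2)⁻¹ : ℝ) : ℂ) * hadamardSign (ε i k) (ε j k)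

theorem hadamard_symm (ε : Fin (w + 1) ≃ (Fin d → Bool)) (i j : Fin (w + 1)) :
    hadamard ε i j = hadamard ε j i :=
  Finset.prod_congr rfl fun k _ => by simp only [hadamardSign, Bool.and_comm]

theorem inv_sqrt_two_mul_self : (((√2)⁻¹ : ℝ) : ℂ) * (((√2)⁻¹ : ℝ) : ℂ) = 1 / 2 := by
  rw [← Complex.ofReal_mul, ← mul_inv, Real.mul_self_sqrt (by norm_num)]
  norm_num

theorem hadamard_mem_unitaryGroup (ε : Fin (w + 1) ≃ (Fin d → Bool)) :
    hadamard ε ∈ Matrix.unitaryGroup (Fin (w + 1)) ℂ := by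
  rw [Matrix.mem_unitaryGroup_iff']
  ext i j
  have hstar : ∀ a, star (hadamard ε a i) = hadamard ε a i := by
    intro a
    simp only [hadamard, star_prod]
    refine Finset.prod_congr rfl fun k _ => ?_
    simp only [hadamardSign]
    split_ifs <;> simp
  simp only [Matrix.mul_apply, Matrix.star_apply, hstar, Matrix.one_apply]
  calc ∑ a, hadamard ε a i * hadamard ε a j
      = ∑ x : Fin d → Bool, ∏ k, ((1 / 2 : ℂ) *
          (hadamardSign (x k) (ε i k) * hadamardSign (x k) (ε j k))) := by
        rw [← Equiv.sum_comp ε]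
        refine Finset.sum_congr rfl fun a _ => ?_
        rw [hadamard, hadamard, ← Finset.prod_mul_distrib]
        refine Finset.prod_congr rfl fun k _ => ?_
        rw [← inv_sqrt_two_mul_self]
        ring
    _ = ∏ k, ∑ b : Bool, ((1 / 2 : ℂ) *
          (hadamardSign b (ε i k) * hadamardSign b (ε j k))) :=
        (Fintype.prod_sum fun k b => (1 / 2 : ℂ) *
          (hadamardSign b (ε i k) * hadamardSign b (ε j k))).symm
    _ = ∏ k, if ε i k = ε j k then (1 : ℂ) else 0 := by
        refine Finset.prod_congr rfl fun k _ => ?_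
        cases ε i k <;> cases ε j k <;> norm_num [hadamardSign]
    _ = if i = j then 1 else 0 := by
        by_cases h : i = j
        · simp [h]
        · obtain ⟨k, hk⟩ := Function.ne_iff.1 (ε.injective.ne h)
          rw [if_neg h]
          exact Finset.prod_eq_zero (Finset.mem_univ k) (if_neg hk)

/-- The Hadamard gate as an element of the unitary group. -/
noncomputable def hadamardGate (ε : Fin (w + 1) ≃ (Fin d → Bool)) :
    Matrix.unitaryGroup (Fin (w + 1)) ℂ := ⟨hadamard ε, hadamard_mem_unitaryGroup ε⟩

/-- The number of qubits in the state `|1⟩`. -/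
def bitCount (ε : Fin (w + 1) ≃ (Fin d → Bool)) (i : Fin (w + 1)) : ℕ :=
  (List.finRange d).countP (ε i)

theorem prod_X_eq_X_pow_bitCount (ε : Fin (w + 1) ≃ (Fin d → Bool)) (i : Fin (w + 1)) :
    ∏ k, (if ε i k then (X : ℂ[X]) else 1) = X ^ bitCount ε i := by
  rw [Fin.prod_univ_def, bitCount]
  induction List.finRange d with
  | nil => simp
  | cons k l ih =>
    rw [List.map_cons, List.prod_cons, ih, List.countP_cons, pow_add, mul_comm]
    cases ε i k <;> simp

/-- Expansion of the Kraus operators of `d` Hadamard tests of the same operator. -/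
theorem prod_krausPoly (ε : Fin (w + 1) ≃ (Fin d → Bool)) (hε : ε 0 = fun _ => false)
    (i : Fin (w + 1)) :
    ∏ k, krausPoly (ε i k) =
      ∑ j, C (hadamard ε i j * hadamard ε j 0) * X ^ bitCount ε j := by
  have h1 : ∀ b, krausPoly b =
      ∑ x : Bool, C (1 / 2 * hadamardSign b x) * (if x then X else 1) := by
    intro b
    cases b <;> simp [krausPoly, hadamardSign] <;> ring
  simp only [h1]
  rw [Fintype.prod_sum, ← Equiv.sum_comp ε]
  refine Finset.sum_congr rfl fun j _ => ?_
  rw [Finset.prod_mul_distrib, prod_X_eq_X_pow_bitCount, ← map_prod, hadamard, hadamard,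
    ← Finset.prod_mul_distrib]
  congr 2
  refine Finset.prod_congr rfl fun k _ => ?_
  rw [← inv_sqrt_two_mul_self, hε]
  simp only [hadamardSign, Bool.and_false]
  simp

variable {H : Type} [NormedAddCommGroup H] [InnerProductSpace ℂ H]

theorem aeval_prod_krausPoly (ε : Fin (w + 1) ≃ (Fin d → Bool)) (hε : ε 0 = fun _ => false)
    (U : Module.End ℂ H) (i : Fin (w + 1)) (v : H) :
    aeval U (∏ k, krausPoly (ε i k)) v =
      ∑ j, (hadamard ε i j * hadamard ε j 0) • (U ^ bitCount ε j) v := by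
  rw [prod_krausPoly ε hε, map_sum, LinearMap.sum_apply]
  simp [Algebra.algebraMap_eq_smul_one, smul_smul, mul_comm]

/-- `d` parallel Hadamard tests of `U`, in terms of powers of `U` controlled by the number of
qubits in the state `|1⟩`. -/
theorem hadamard_test (ε : Fin (w + 1) ≃ (Fin d → Bool)) (hε : ε 0 = fun _ => false)
    (U : Module.End ℂ H) (i : Fin (w + 1)) (v : H) :
    ∑ j, hadamard ε i j • (U ^ bitCount ε j)
        (∑ l, hadamard ε j l • (Pi.single 0 v : Fin (w + 1) → H) l) =
      aeval U (∏ k, krausPoly (ε i k)) v := by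
  rw [aeval_prod_krausPoly ε hε]
  refine Finset.sum_congr rfl fun j _ => ?_
  rw [Finset.sum_eq_single 0 (fun l _ hl => by simp [hl]) (by simp), Pi.single_eq_same, map_smul,
    smul_smul]

/-- Undoing the Hadamard tests: the component of the workspace state `|0⟩`. -/
theorem hadamard_untest (ε : Fin (w + 1) ≃ (Fin d → Bool)) (hε : ε 0 = fun _ => false)
    (U : Module.End ℂ H) (u : Fin (w + 1) → H) :
    ∑ j, hadamard ε 0 j • (U ^ bitCount ε j) (∑ i, hadamard ε j i • u i) =
      ∑ i, aeval U (∏ k, krausPoly (ε i k)) (u i) := by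
  simp only [aeval_prod_krausPoly ε hε, map_sum, map_smul, Finset.smul_sum, smul_smul]
  rw [Finset.sum_comm]
  refine Finset.sum_congr rfl fun i _ => Finset.sum_congr rfl fun j _ => ?_
  rw [hadamard_symm ε 0 j, hadamard_symm ε j i, mul_comm]

end Hadamard

/-! ### Concentration of the number of successes in independent trials -/

/-- The number of bits that are `false`; it is the number of Hadamard tests of the Grover iterate
with the outcome of probability `‖T ψ‖ ^ 2`. -/
def falseCount {d : ℕ} (y : Fin d → Bool) : ℕ := ∑ k, if y k then 0 else 1

theorem falseCount_le {d : ℕ} (y : Fin d → Bool) : falseCount y ≤ d := by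
  calc falseCount y ≤ ∑ _k : Fin d, 1 := Finset.sum_le_sum fun k _ => by split_ifs <;> simp
    _ = d := by simp

theorem krausWeight_nonneg {p : ℝ} (h0 : 0 ≤ p) (h1 : p ≤ 1) (b : Bool) : 0 ≤ krausWeight p b := by
  cases b <;> simp [krausWeight] <;> linarith

theorem sum_prod_krausWeight (p : ℝ) (d : ℕ) :
    ∑ y : Fin d → Bool, ∏ k, krausWeight p (y k) = 1 := by
  rw [← Fintype.prod_sum fun (_ : Fin d) b => krausWeight p b]
  simp [krausWeight]

theorem sum_prod_krausWeight_mul_exp (p s : ℝ) (d : ℕ) :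
    ∑ y : Fin d → Bool, (∏ k, krausWeight p (y k)) * Real.exp (s * falseCount y) =
      (1 - p + p * Real.exp s) ^ d := by
  have : ∀ y : Fin d → Bool, (∏ k, krausWeight p (y k)) * Real.exp (s * falseCount y) =
      ∏ k, krausWeight p (y k) * (if y k then 1 else Real.exp s) := by
    intro y
    rw [Finset.prod_mul_distrib, falseCount]
    push_cast
    rw [Finset.mul_sum, Real.exp_sum]
    congr 1
    refine Finset.prod_congr rfl fun k _ => ?_
    split_ifs <;> simp
  simp only [this]
  rw [← Fintype.prod_sum fun (_ : Fin d) b => krausWeight p b * (if b then 1 else Real.exp s)]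
  simp [krausWeight]

theorem sum_prod_krausWeight_mul_exp_le {p s : ℝ} (h0 : 0 ≤ p) (h1 : p ≤ 1) (hs : |s| ≤ 1)
    (d : ℕ) :
    ∑ y : Fin d → Bool, (∏ k, krausWeight p (y k)) * Real.exp (s * (falseCount y - d * p)) ≤
      Real.exp (d * s ^ 2) := by
  -- `1 + p (exp s - 1) ≤ 1 + p (s + s ^ 2)`, as `exp s ≤ 1 + s + s ^ 2` for `|s| ≤ 1`
  have h2 : 1 - p + p * Real.exp s ≤ Real.exp (p * s + s ^ 2) := by
    have h3 := (abs_le.1 (Real.abs_exp_sub_one_sub_id_le hs)).2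
    have h4 := Real.add_one_le_exp (p * s + s ^ 2)
    nlinarith [sq_nonneg s]
  have h5 : 0 ≤ 1 - p + p * Real.exp s := by
    have := Real.exp_pos s
    nlinarith
  calc _ = (1 - p + p * Real.exp s) ^ d * Real.exp (-(s * (d * p))) := by
        rw [← sum_prod_krausWeight_mul_exp, Finset.sum_mul]
        refine Finset.sum_congr rfl fun y _ => ?_
        rw [mul_assoc, ← Real.exp_add]
        ring_nf
    _ ≤ Real.exp (p * s + s ^ 2) ^ d * Real.exp (-(s * (d * p))) := by gcongr
    _ = Real.exp (d * s ^ 2) := by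
        rw [← Real.exp_nat_mul, ← Real.exp_add]
        ring_nf

open Classical in
/-- A Chernoff bound for the binomial distribution. -/
theorem sum_prod_krausWeight_tail_le {p c : ℝ} (h0 : 0 ≤ p) (h1 : p ≤ 1) (hc0 : 0 ≤ c)
    (hc : c ≤ 2) (d : ℕ) :
    ∑ y : Fin d → Bool, (if d * c ≤ |falseCount y - d * p| then ∏ k, krausWeight p (y k) else 0) ≤
      2 * Real.exp (-(d * c ^ 2 / 4)) := by
  -- the exponential moments at `± c / 2`, where `d s ^ 2 - d s c` is minimal
  have hs : |c / 2| ≤ 1 := by rw [abs_le]; constructor <;> linarith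
  have hs' : |-(c / 2)| ≤ 1 := by rwa [abs_neg]
  have e1 := sum_prod_krausWeight_mul_exp_le h0 h1 hs d
  have e2 := sum_prod_krausWeight_mul_exp_le h0 h1 hs' d
  have key : ∀ y : Fin d → Bool,
      (if d * c ≤ |falseCount y - d * p| then ∏ k, krausWeight p (y k) else 0) ≤
      ((∏ k, krausWeight p (y k)) * Real.exp (c / 2 * (falseCount y - d * p)) +
        (∏ k, krausWeight p (y k)) * Real.exp (-(c / 2) * (falseCount y - d * p))) *
        Real.exp (-(c / 2 * (d * c))) := by
    intro y
    have hw : 0 ≤ ∏ k, krausWeight p (y k) :=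
      Finset.prod_nonneg fun k _ => krausWeight_nonneg h0 h1 _
    split_ifs with h
    · rw [add_mul, mul_assoc, mul_assoc, ← Real.exp_add, ← Real.exp_add, ← mul_add]
      refine le_mul_of_one_le_right hw ?_
      rcases le_abs'.1 h with h | h
      · refine le_add_of_nonneg_of_le (Real.exp_pos _).le (Real.one_le_exp ?_)
        nlinarith
      · refine le_add_of_le_of_nonneg (Real.one_le_exp ?_) (Real.exp_pos _).le
        nlinarith
    · positivity
  calc _ ≤ _ := Finset.sum_le_sum fun y _ => key y
    _ ≤ (Real.exp (d * (c / 2) ^ 2) + Real.exp (d * (-(c / 2)) ^ 2)) *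
          Real.exp (-(c / 2 * (d * c))) := by
        rw [← Finset.sum_mul, Finset.sum_add_distrib]
        gcongr
    _ = 2 * Real.exp (-(d * c ^ 2 / 4)) := by
        rw [neg_sq, ← two_mul, mul_assoc, ← Real.exp_add]
        ring_nf

/-! ### The amplitude estimation program -/

namespace QProg

variable {Q : Type} {w d : ℕ} {α : Type}

/-- Every output that occurs in the program satisfies `P`. -/
def AllOutputs (P : α → Prop) : QProg Q w α → Prop
  | ret a => P a
  | gate _ next => next.AllOutputs P
  | query _ _ next => next.AllOutputs P
  | meas _ next => ∀ o, (next o).AllOutputs P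
  | fresh next => next.AllOutputs P

variable {H : Type} [NormedAddCommGroup H] [InnerProductSpace ℂ H]

theorem prob_congr_of_allOutputs {P : α → Prop} {E E' : α → (Fin (w + 1) → H) → Prop}
    (h : ∀ a u, P a → (E a u ↔ E' a u)) (O : Q → H → H) {p : QProg Q w α} (hp : p.AllOutputs P)
    (v : Fin (w + 1) → H) : p.prob O E v = p.prob O E' v := by
  induction p generalizing v with
  | ret a =>
    have h1 := h a v hp
    by_cases h2 : E a v <;> simp [prob, h2, ← h1]
  | gate U next ih => exact ih hp _
  | query q c next ih => exact ih hp _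
  | meas f next ih => exact Finset.sum_congr rfl fun o _ => ih o (hp o) _
  | fresh next ih => exact Finset.sum_congr rfl fun o _ => ih hp _

/-- Apply the Grover iterate, controlled by each of the listed qubits. -/
def controlledGrover (ε : Fin (w + 1) ≃ (Fin d → Bool)) :
    List (Fin d) → QProg AEQuery w α → QProg AEQuery w α
  | [], p => p
  | k :: l, p => query .proj (fun i => ε i k) (query .state (fun i => ε i k)
      (controlledGrover ε l p))

/-- Apply the inverse of the Grover iterate, controlled by each of the listed qubits. -/
def controlledGroverInv (ε : Fin (w + 1) ≃ (Fin d → Bool)) :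
    List (Fin d) → QProg AEQuery w α → QProg AEQuery w α
  | [], p => p
  | k :: l, p => query .state (fun i => ε i k) (query .proj (fun i => ε i k)
      (controlledGroverInv ε l p))

/-- Bring the data register back to the state, in at most `r` rounds, and output `e`.  A round
measures whether the register is in the state, by Hadamard tests of the reflection through the
state on all qubits at once (powers of the reflection depend on the parity of the exponent only, so
that a single controlled call is enough); on failure it applies the reflection through the
projection. -/
noncomputable def restoreLoop (ε : Fin (w + 1) ≃ (Fin d → Bool)) (e : ℝ) :
    ℕ → QProg AEQuery w ℝ
  | 0 => ret e
  | r + 1 => gate (hadamardGate ε) (query .state (fun i => bitCount ε i % 2 = 1)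
      (gate (hadamardGate ε) (meas id fun o =>
        if o = 0 then query .proj (fun _ => true) (restoreLoop ε e r) else ret e)))

/-- The number `a` of successes among `d` trials, where very small and very large numbers are
identified with `0` and `d`.  The margin `1/36` is twice the accuracy `1/72` of `a / d`, so that for
`p ≤ 1/72` and for `p ≥ 71/72` a single value is almost certain. -/
def roundCount (d a : ℕ) : ℕ := if 36 * a < d then 0 else if 35 * d < 36 * a then d else a

/-- The rounded number of successes as a measurement outcome.  It is at most `d`, hence there is no
wrap-around if `d ≤ w`. -/
def aeLabel (ε : Fin (w + 1) ≃ (Fin d → Bool)) (i : Fin (w + 1)) : Fin (w + 1) :=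
  Fin.ofNat (w + 1) (roundCount d (falseCount (ε i)))

/-- The estimate for the rounded number `o` of successes among `d` trials.  Labels `o > d` do not
occur; the minimum keeps the corresponding branches of the program in range. -/
noncomputable def aeValue (d : ℕ) (o : Fin (w + 1)) : ℝ := min 1 ((o : ℕ) / d)

/-- Undo the Hadamard tests, and then restore the state. -/
noncomputable def aeUncompute (ε : Fin (w + 1) ≃ (Fin d → Bool)) (R : ℕ) (e : ℝ) :
    QProg AEQuery w ℝ :=
  gate (hadamardGate ε) (controlledGroverInv ε (List.finRange d) (gate (hadamardGate ε)
    (fresh (restoreLoop ε e R))))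

/-- Nondestructive amplitude estimation by `d` Hadamard tests of the Grover iterate, of which only
the rounded number of successes is measured, followed by at most `R` rounds of restoring. -/
noncomputable def amplitudeEstimation (ε : Fin (w + 1) ≃ (Fin d → Bool)) (R : ℕ) :
    QProg AEQuery w ℝ :=
  gate (hadamardGate ε) (controlledGrover ε (List.finRange d) (gate (hadamardGate ε)
    (meas (aeLabel ε) fun o => aeUncompute ε R (aeValue d o))))

/-! ### The outputs and the cost of amplitude estimation -/

theorem AllOutputs.controlledGrover {P : α → Prop} (ε : Fin (w + 1) ≃ (Fin d → Bool))
    (l : List (Fin d)) {p : QProg AEQuery w α} (hp : p.AllOutputs P) :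
    (controlledGrover ε l p).AllOutputs P := by
  induction l with
  | nil => exact hp
  | cons k l ih => exact ih

theorem AllOutputs.controlledGroverInv {P : α → Prop} (ε : Fin (w + 1) ≃ (Fin d → Bool))
    (l : List (Fin d)) {p : QProg AEQuery w α} (hp : p.AllOutputs P) :
    (controlledGroverInv ε l p).AllOutputs P := by
  induction l with
  | nil => exact hp
  | cons k l ih => exact ih

theorem allOutputs_restoreLoop {P : ℝ → Prop} (ε : Fin (w + 1) ≃ (Fin d → Bool)) {e : ℝ}
    (he : P e) (r : ℕ) : (restoreLoop ε e r).AllOutputs P := by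
  induction r with
  | zero => exact he
  | succ r ih =>
    intro o
    dsimp only
    split_ifs
    · exact ih
    · exact he

theorem allOutputs_aeUncompute {P : ℝ → Prop} (ε : Fin (w + 1) ≃ (Fin d → Bool)) {e : ℝ}
    (he : P e) (R : ℕ) : (aeUncompute ε R e).AllOutputs P :=
  AllOutputs.controlledGroverInv (p := gate _ _) ε _ (allOutputs_restoreLoop ε he R)

theorem allOutputs_amplitudeEstimation (ε : Fin (w + 1) ≃ (Fin d → Bool)) (R : ℕ) :
    (amplitudeEstimation ε R).AllOutputs (fun e => e ∈ Set.Icc (0 : ℝ) 1) :=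
  AllOutputs.controlledGrover (p := gate _ _) ε _ fun _ => allOutputs_aeUncompute ε
    ⟨le_min zero_le_one (by positivity), min_le_left _ _⟩ R

theorem queries_controlledGrover (ε : Fin (w + 1) ≃ (Fin d → Bool)) (l : List (Fin d))
    (p : QProg AEQuery w α) :
    (controlledGrover ε l p).queries (fun _ => 1) = 2 * l.length + p.queries (fun _ => 1) := by
  induction l with
  | nil => simp [controlledGrover]
  | cons k l ih => simp only [controlledGrover, queries, ih, List.length_cons]; ring

theorem queries_controlledGroverInv (ε : Fin (w + 1) ≃ (Fin d → Bool)) (l : List (Fin d))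
    (p : QProg AEQuery w α) :
    (controlledGroverInv ε l p).queries (fun _ => 1) = 2 * l.length + p.queries (fun _ => 1) := by
  induction l with
  | nil => simp [controlledGroverInv]
  | cons k l ih => simp only [controlledGroverInv, queries, ih, List.length_cons]; ring

theorem queries_restoreLoop_le (ε : Fin (w + 1) ≃ (Fin d → Bool)) (e : ℝ) (r : ℕ) :
    (restoreLoop ε e r).queries (fun _ => 1) ≤ 2 * r := by
  induction r with
  | zero => simp [restoreLoop, queries]
  | succ r ih =>
    simp only [restoreLoop, queries]
    have : ∀ o : Fin (w + 1), (if o = 0 then query .proj (fun _ => true) (restoreLoop ε e r)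
        else ret e).queries (fun _ : AEQuery => 1) ≤ 2 * r + 1 := by
      intro o
      split_ifs
      · simp only [queries]; omega
      · simp [queries]
    have h2 := Finset.sup_le fun o (_ : o ∈ Finset.univ) => this o
    omega

theorem queries_amplitudeEstimation_le (ε : Fin (w + 1) ≃ (Fin d → Bool)) (R : ℕ) :
    (amplitudeEstimation ε R).queries (fun _ => 1) ≤ 4 * d + 2 * R := by
  simp only [amplitudeEstimation, queries, queries_controlledGrover, List.length_finRange]
  have : ∀ o : Fin (w + 1), (aeUncompute ε R (aeValue d o)).queries (fun _ => 1)
      ≤ 2 * d + 2 * R := by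
    intro o
    simp only [aeUncompute, queries, queries_controlledGroverInv, List.length_finRange]
    have := queries_restoreLoop_le ε (aeValue d o) R
    omega
  have h2 := Finset.sup_le fun o (_ : o ∈ Finset.univ) => this o
  omega

/-! ### Restoring the state -/

open Polynomial

theorem prob_controlledGrover (ε : Fin (w + 1) ≃ (Fin d → Bool)) (ψ : H) (T : H →ₗ[ℂ] H)
    (E : α → (Fin (w + 1) → H) → Prop) (l : List (Fin d)) (p : QProg AEQuery w α)
    (v : Fin (w + 1) → H) :
    (controlledGrover ε l p).prob (aeOracle ψ T) E v =
      p.prob (aeOracle ψ T) E (fun i => (grover ψ T ^ l.countP (ε i)) (v i)) := by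
  induction l generalizing v with
  | nil => simp [controlledGrover]
  | cons k l ih =>
    simp only [controlledGrover, prob, ih]
    congr 1
    funext i
    rw [List.countP_cons]
    split_ifs
    · rw [pow_succ, Module.End.mul_apply, grover_apply]; rfl
    · simp

theorem prob_controlledGroverInv (ε : Fin (w + 1) ≃ (Fin d → Bool)) (ψ : H) (T : H →ₗ[ℂ] H)
    (E : α → (Fin (w + 1) → H) → Prop) (l : List (Fin d)) (p : QProg AEQuery w α)
    (v : Fin (w + 1) → H) :
    (controlledGroverInv ε l p).prob (aeOracle ψ T) E v =
      p.prob (aeOracle ψ T) E (fun i => (groverInv ψ T ^ l.countP (ε i)) (v i)) := by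
  induction l generalizing v with
  | nil => simp [controlledGroverInv]
  | cons k l ih =>
    simp only [controlledGroverInv, prob, ih]
    congr 1
    funext i
    rw [List.countP_cons]
    split_ifs
    · rw [pow_succ, Module.End.mul_apply, groverInv_apply]; rfl
    · simp

/-- The reflection through `ψ` as a linear map. -/
noncomputable def stateRefl (ψ : H) : Module.End ℂ H := 1 - (2 : ℂ) • stateProj ψ

theorem stateRefl_apply (ψ v : H) : stateRefl ψ v = reflState ψ v := by
  simp [stateRefl, reflState_eq_reflProj, reflProj]

theorem norm_pow_apply {U : Module.End ℂ H} (hU : ∀ v, ‖U v‖ = ‖v‖) (n : ℕ) (v : H) :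
    ‖(U ^ n) v‖ = ‖v‖ := by
  induction n with
  | zero => simp
  | succ n ih => rw [pow_succ', Module.End.mul_apply, hU, ih]

variable {ψ : H} {T : H →ₗ[ℂ] H}

theorem norm_stateRefl (hψ : ‖ψ‖ = 1) (v : H) : ‖stateRefl ψ v‖ = ‖v‖ := by
  rw [stateRefl_apply, reflState_eq_reflProj]
  exact norm_reflProj (stateProj_isSymmetricProjection hψ) v

theorem stateRefl_pow_apply (hψ : ‖ψ‖ = 1) (n : ℕ) (v : H) :
    (stateRefl ψ ^ n) v = if n % 2 = 1 then reflState ψ v else v := by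
  induction n with
  | zero => simp
  | succ n ih =>
    rw [pow_succ', Module.End.mul_apply, ih, stateRefl_apply]
    rcases Nat.mod_two_eq_zero_or_one n with h | h
    · simp [h, Nat.add_mod]
    · simp [h, Nat.add_mod, reflState_eq_reflProj,
        reflProj_reflProj (stateProj_isSymmetricProjection hψ)]

theorem aeval_stateRefl_krausPoly (b : Bool) :
    aeval (stateRefl ψ) (krausPoly b) = if b then stateProj ψ else 1 - stateProj ψ := by
  ext v
  rw [aeval_krausPoly, stateRefl]
  cases b
  · simp
    module
  · simp

/-- The Hadamard tests of the reflection through `ψ` all give the same outcome: the component of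
the workspace state `|0⟩` is orthogonal to `ψ`. -/
theorem aeval_stateRefl_zero (hψ : ‖ψ‖ = 1) (hd : d ≠ 0) (ε : Fin (w + 1) ≃ (Fin d → Bool))
    (hε : ε 0 = fun _ => false) (x : H) :
    aeval (stateRefl ψ) (∏ k, krausPoly (ε 0 k)) x = x - stateProj ψ x := by
  obtain ⟨n, rfl⟩ := Nat.exists_eq_succ_of_ne_zero hd
  have h := (stateProj_isSymmetricProjection hψ).isIdempotentElem.one_sub.pow_succ_eq n
  simp [hε, aeval_stateRefl_krausPoly, h]

theorem aeval_stateRefl_ne_zero (ε : Fin (w + 1) ≃ (Fin d → Bool))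
    (hε : ε 0 = fun _ => false) {i : Fin (w + 1)} (hi : i ≠ 0) (x : H) :
    ∃ c : ℂ, aeval (stateRefl ψ) (∏ k, krausPoly (ε i k)) x = c • ψ := by
  obtain ⟨k, hk⟩ : ∃ k, ε i k = true := by
    by_contra! h
    exact hi (ε.injective (by rw [hε]; funext k; simpa using h k))
  rw [← Finset.mul_prod_erase _ _ (Finset.mem_univ k), map_mul, Module.End.mul_apply, hk,
    aeval_stateRefl_krausPoly, if_pos rfl, stateProj_apply]
  exact ⟨_, rfl⟩

theorem sum_norm_sq_aeval {U : Module.End ℂ H} (hU : ∀ v, ‖U v‖ = ‖v‖)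
    (ε : Fin (w + 1) ≃ (Fin d → Bool)) (hε : ε 0 = fun _ => false) (x : H) :
    ∑ i, ‖aeval U (∏ k, krausPoly (ε i k)) x‖ ^ 2 = ‖x‖ ^ 2 := by
  simp only [← hadamard_test ε hε]
  rw [sum_norm_sq_unitary (hadamard_mem_unitaryGroup ε) fun j => (U ^ bitCount ε j)
    (∑ l, hadamard ε j l • (Pi.single 0 x : Fin (w + 1) → H) l)]
  simp only [norm_pow_apply hU]
  rw [sum_norm_sq_unitary (hadamard_mem_unitaryGroup ε), sum_norm_sq_single]

theorem prob_ret_restored (e : ℝ) (c : Fin (w + 1) → ℂ) (O : Q → H → H) {v : Fin (w + 1) → H}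
    (hv : ∀ i, v i = c i • ψ) :
    (ret e : QProg Q w ℝ).prob O (fun _ u => Restored ψ u) v = ∑ i, ‖v i‖ ^ 2 := by
  have : Restored ψ v := ⟨c, hv⟩
  simp [prob, this]

/-- The first round restores the component of `x` along `ψ`, and passes on the reflection of the
rest to the following rounds. -/
theorem le_prob_restoreLoop_succ (hψ : ‖ψ‖ = 1) (hd : d ≠ 0) (ε : Fin (w + 1) ≃ (Fin d → Bool))
    (hε : ε 0 = fun _ => false) (e : ℝ) (r : ℕ) (x : H) :
    ‖stateProj ψ x‖ ^ 2 + (restoreLoop ε e r).prob (aeOracle ψ T) (fun _ u => Restored ψ u)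
        (Pi.single 0 (reflProj T (x - stateProj ψ x))) ≤
      (restoreLoop ε e (r + 1)).prob (aeOracle ψ T) (fun _ u => Restored ψ u)
        (Pi.single 0 x) := by
  have hpow : ∀ (i : Fin (w + 1)) (v : H), (if decide (bitCount ε i % 2 = 1) = true then
      aeOracle ψ T .state v else v) = (stateRefl ψ ^ bitCount ε i) v := by
    intro i v
    rw [stateRefl_pow_apply hψ]
    simp [aeOracle]
  simp only [restoreLoop, prob, hpow, hadamardGate, hadamard_test ε hε]
  rw [Fin.sum_univ_succ, if_pos rfl, prob]
  have h0 : (fun i : Fin (w + 1) => if (fun _ => true) i = true then aeOracle ψ T .proj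
      (if id i = 0 then aeval (stateRefl ψ) (∏ k, krausPoly (ε i k)) x else 0)
      else if id i = 0 then aeval (stateRefl ψ) (∏ k, krausPoly (ε i k)) x else 0) =
      Pi.single 0 (reflProj T (x - stateProj ψ x)) := by
    funext i
    by_cases hi : i = 0
    · subst hi
      simp [aeval_stateRefl_zero hψ hd ε hε, aeOracle]
    · simp [hi, aeOracle, reflProj]
  rw [h0, add_comm]
  refine add_le_add_right (le_of_eq ?_) _
  have hsum := sum_norm_sq_aeval (norm_stateRefl hψ) ε hε x
  rw [Fin.sum_univ_succ, aeval_stateRefl_zero hψ hd ε hε, norm_sub_stateProj_sq hψ] at hsum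
  have hS : ‖stateProj ψ x‖ ^ 2 =
      ∑ i : Fin w, ‖aeval (stateRefl ψ) (∏ k, krausPoly (ε i.succ k)) x‖ ^ 2 := by linarith
  rw [hS]
  refine Finset.sum_congr rfl fun i _ => ?_
  rw [if_neg (Fin.succ_ne_zero i)]
  obtain ⟨c, hc⟩ := aeval_stateRefl_ne_zero (ψ := ψ) ε hε (Fin.succ_ne_zero i) x
  rw [prob_ret_restored e (fun j => if j = i.succ then c else 0)]
  · rw [Finset.sum_eq_single i.succ] <;> simp +contextual
  · intro j
    by_cases hj : j = i.succ
    · subst hj; simp [hc]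
    · simp [hj]

/-- Every round but the first one succeeds with probability `4 p (1 - p)`. -/
theorem le_prob_restoreLoop (hψ : ‖ψ‖ = 1) (hT : T.IsSymmetricProjection) (hd : d ≠ 0)
    (ε : Fin (w + 1) ≃ (Fin d → Bool)) (hε : ε 0 = fun _ => false) (e : ℝ) (r : ℕ) {x : H}
    (hx : x ∈ aePlane ψ T) :
    ‖x‖ ^ 2 - (1 - 4 * ‖T ψ‖ ^ 2 * (1 - ‖T ψ‖ ^ 2)) ^ r * ‖x - stateProj ψ x‖ ^ 2 ≤
      (restoreLoop ε e (r + 1)).prob (aeOracle ψ T) (fun _ u => Restored ψ u)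
        (Pi.single 0 x) := by
  induction r generalizing x with
  | zero =>
    refine le_trans ?_ (le_prob_restoreLoop_succ hψ hd ε hε e 0 x)
    have := prob_nonneg (aeOracle ψ T) (fun _ u => Restored ψ u) (restoreLoop ε e 0)
      (Pi.single 0 (reflProj T (x - stateProj ψ x)))
    rw [norm_sub_stateProj_sq hψ]
    linarith
  | succ r ih =>
    refine le_trans ?_ (le_prob_restoreLoop_succ hψ hd ε hε e (r + 1) x)
    have h := ih (reflProj_mem_aePlane hT (Submodule.sub_mem _ hx (stateProj_mem_aePlane x)))
    rw [norm_sub_stateProj_sq hψ (reflProj T _), norm_stateProj_reflProj_sq hψ hT hx,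
      norm_reflProj hT] at h
    have h2 := norm_sub_stateProj_sq hψ x
    calc _ = ‖stateProj ψ x‖ ^ 2 + (‖x - stateProj ψ x‖ ^ 2 -
          (1 - 4 * ‖T ψ‖ ^ 2 * (1 - ‖T ψ‖ ^ 2)) ^ r * (‖x - stateProj ψ x‖ ^ 2 -
            4 * ‖T ψ‖ ^ 2 * (1 - ‖T ψ‖ ^ 2) * ‖x - stateProj ψ x‖ ^ 2)) := by
          rw [pow_succ, h2]; ring
      _ ≤ _ := add_le_add_right h _

/-! ### Correctness of amplitude estimation -/

theorem norm_grover (hψ : ‖ψ‖ = 1) (hT : T.IsSymmetricProjection) (v : H) :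
    ‖grover ψ T v‖ = ‖v‖ := by
  rw [grover_apply, reflState_eq_reflProj, norm_reflProj (stateProj_isSymmetricProjection hψ),
    norm_reflProj hT]

theorem norm_groverInv (hψ : ‖ψ‖ = 1) (hT : T.IsSymmetricProjection) (v : H) :
    ‖groverInv ψ T v‖ = ‖v‖ := by
  rw [groverInv_apply, reflState_eq_reflProj, norm_reflProj hT,
    norm_reflProj (stateProj_isSymmetricProjection hψ)]

theorem groverInv_pow_mem_aePlane (hT : T.IsSymmetricProjection) (n : ℕ) {v : H}
    (hv : v ∈ aePlane ψ T) : (groverInv ψ T ^ n) v ∈ aePlane ψ T := by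
  induction n with
  | zero => simpa using hv
  | succ n ih =>
    rw [pow_succ', Module.End.mul_apply, groverInv_apply]
    exact reflProj_mem_aePlane hT (reflState_mem_aePlane ih)

/-- The state when the label `o` of the number of successes has been measured. -/
theorem probFrom_amplitudeEstimation (ε : Fin (w + 1) ≃ (Fin d → Bool))
    (hε : ε 0 = fun _ => false) (R : ℕ) (E : ℝ → (Fin (w + 1) → H) → Prop) :
    (amplitudeEstimation ε R).probFrom (aeOracle ψ T) ψ E =
      ∑ o, (aeUncompute ε R (aeValue d o)).prob (aeOracle ψ T) E
        (fun i => if aeLabel ε i = o then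
          aeval (grover ψ T) (∏ k, krausPoly (ε i k)) ψ else 0) := by
  simp only [probFrom, amplitudeEstimation, prob, prob_controlledGrover]
  have : ∀ i, (List.finRange d).countP (ε i) = bitCount ε i := fun i => rfl
  simp only [this, hadamardGate, hadamard_test ε hε]

open Classical in
/-- The rounded number of successes is that of `d` independent trials. -/
theorem probFrom_amplitudeEstimation_output (hψ : ‖ψ‖ = 1) (hT : T.IsSymmetricProjection)
    (ε : Fin (w + 1) ≃ (Fin d → Bool)) (hε : ε 0 = fun _ => false) (R : ℕ) (F : ℝ → Prop) :
    (amplitudeEstimation ε R).probFrom (aeOracle ψ T) ψ (fun e _ => F e) =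
      ∑ i, if F (aeValue d (aeLabel ε i)) then ∏ k, krausWeight (‖T ψ‖ ^ 2) (ε i k) else 0 := by
  rw [probFrom_amplitudeEstimation ε hε]
  have h1 : ∀ (o : Fin (w + 1)) (v : Fin (w + 1) → H),
      (aeUncompute ε R (aeValue d o)).prob (aeOracle ψ T) (fun e _ => F e) v =
        if F (aeValue d o) then ∑ i, ‖v i‖ ^ 2 else 0 := by
    intro o v
    have hout := allOutputs_aeUncompute (P := fun e => e = aeValue d o) ε rfl R
    split_ifs with h
    · rw [← prob_true (norm_aeOracle hψ hT) (aeUncompute ε R (aeValue d o)) v]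
      exact prob_congr_of_allOutputs (fun a u ha => by simp [ha, h]) _ hout v
    · rw [← prob_false (aeOracle ψ T) (aeUncompute ε R (aeValue d o)) v]
      exact prob_congr_of_allOutputs (fun a u ha => by simp [ha, h]) _ hout v
  simp only [h1]
  have h2 : ∀ o : Fin (w + 1), (if F (aeValue d o) then ∑ i, ‖if aeLabel ε i = o then
      aeval (grover ψ T) (∏ k, krausPoly (ε i k)) ψ else 0‖ ^ 2 else 0) =
      ∑ i, if aeLabel ε i = o then (if F (aeValue d (aeLabel ε i)) then
        ∏ k, krausWeight (‖T ψ‖ ^ 2) (ε i k) else 0) else 0 := by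
    intro o
    by_cases h : F (aeValue d o)
    · rw [if_pos h]
      refine Finset.sum_congr rfl fun i _ => ?_
      split_ifs with h3 h4
      · rw [norm_aeval_prod_krausPoly_sq hψ hT _ _ state_mem_aePlane, hψ]; ring
      · exact absurd (h3 ▸ h) ‹_›
      · simp
    · rw [if_neg h, eq_comm]
      refine Finset.sum_eq_zero fun i _ => ?_
      split_ifs with h3 h4
      · exact absurd (h3 ▸ h4) h
      · rfl
      · rfl
  simp only [h2]
  rw [Finset.sum_comm]
  simp

open Classical in
/-- A property that holds whenever the relative number of successes is close to `p = ‖T ψ‖ ^ 2`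
holds with high probability. -/
theorem le_sum_prod_krausWeight {p c : ℝ} (h0 : 0 ≤ p) (h1 : p ≤ 1) (hc0 : 0 ≤ c) (hc : c ≤ 2)
    (ε : Fin (w + 1) ≃ (Fin d → Bool)) {F : Fin (w + 1) → Prop}
    (hF : ∀ i, |falseCount (ε i) - d * p| < d * c → F i) :
    1 - 2 * Real.exp (-(d * c ^ 2 / 4)) ≤
      ∑ i, if F i then ∏ k, krausWeight p (ε i k) else 0 := by
  have ht := sum_prod_krausWeight_tail_le h0 h1 hc0 hc d
  have hs := sum_prod_krausWeight p d
  rw [← Equiv.sum_comp ε] at ht hs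
  have key : ∑ i, ∏ k, krausWeight p (ε i k) ≤
      ∑ i, ((if F i then ∏ k, krausWeight p (ε i k) else 0) +
        if d * c ≤ |falseCount (ε i) - d * p| then ∏ k, krausWeight p (ε i k) else 0) := by
    refine Finset.sum_le_sum fun i _ => ?_
    have hw : 0 ≤ ∏ k, krausWeight p (ε i k) :=
      Finset.prod_nonneg fun k _ => krausWeight_nonneg h0 h1 _
    by_cases h : d * c ≤ |falseCount (ε i) - d * p|
    · rw [if_pos h]
      split_ifs <;> linarith
    · rw [if_pos (hF i (not_le.1 h)), if_neg h, add_zero]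
  rw [Finset.sum_add_distrib, hs] at key
  linarith

theorem prob_aeUncompute (ε : Fin (w + 1) ≃ (Fin d → Bool)) (R : ℕ) (e : ℝ)
    (E : ℝ → (Fin (w + 1) → H) → Prop) (u : Fin (w + 1) → H) :
    (aeUncompute ε R e).prob (aeOracle ψ T) E u =
      ∑ i, (restoreLoop ε e R).prob (aeOracle ψ T) E (Pi.single 0
        (∑ j, hadamard ε i j • (groverInv ψ T ^ bitCount ε j) (∑ l, hadamard ε j l • u l))) := by
  simp only [aeUncompute, prob, prob_controlledGroverInv]
  rfl

/-- If neither `p = ‖T ψ‖ ^ 2` nor `1 - p` is small, then the state is restored by the rounds of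
restoring, whatever the measurement of the number of successes has done to it. -/
theorem le_prob_aeUncompute (hψ : ‖ψ‖ = 1) (hT : T.IsSymmetricProjection) (hd : d ≠ 0)
    (ε : Fin (w + 1) ≃ (Fin d → Bool)) (hε : ε 0 = fun _ => false) (r : ℕ) (e : ℝ)
    {u : Fin (w + 1) → H} (hu : ∀ i, u i ∈ aePlane ψ T) :
    (1 - (1 - 4 * ‖T ψ‖ ^ 2 * (1 - ‖T ψ‖ ^ 2)) ^ r) * ∑ i, ‖u i‖ ^ 2 ≤
      (aeUncompute ε (r + 1) e).prob (aeOracle ψ T) (fun _ v => Restored ψ v) u := by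
  have hsum : ∑ i, ‖u i‖ ^ 2 = ∑ i, ‖∑ j, hadamard ε i j • (groverInv ψ T ^ bitCount ε j)
      (∑ l, hadamard ε j l • u l)‖ ^ 2 := by
    rw [sum_norm_sq_unitary (hadamard_mem_unitaryGroup ε) fun j => (groverInv ψ T ^ bitCount ε j)
      (∑ l, hadamard ε j l • u l)]
    simp only [norm_pow_apply (norm_groverInv hψ hT)]
    rw [sum_norm_sq_unitary (hadamard_mem_unitaryGroup ε)]
  rw [prob_aeUncompute, hsum, Finset.mul_sum]
  refine Finset.sum_le_sum fun i _ => ?_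
  have hx : ∑ j, hadamard ε i j • (groverInv ψ T ^ bitCount ε j) (∑ l, hadamard ε j l • u l)
      ∈ aePlane ψ T :=
    Submodule.sum_mem _ fun j _ => Submodule.smul_mem _ _ <| groverInv_pow_mem_aePlane hT _ <|
      Submodule.sum_mem _ fun l _ => Submodule.smul_mem _ _ (hu l)
  refine le_trans ?_ (le_prob_restoreLoop hψ hT hd ε hε e r hx)
  have h1 := norm_sub_stateProj_sq hψ (∑ j, hadamard ε i j • (groverInv ψ T ^ bitCount ε j)
    (∑ l, hadamard ε j l • u l))
  have h2 : 0 ≤ (1 - 4 * ‖T ψ‖ ^ 2 * (1 - ‖T ψ‖ ^ 2)) ^ r :=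
    pow_nonneg (by nlinarith [sq_nonneg (1 - 2 * ‖T ψ‖ ^ 2)]) r
  rw [h1]
  nlinarith [mul_nonneg h2 (sq_nonneg ‖stateProj ψ (∑ j, hadamard ε i j •
    (groverInv ψ T ^ bitCount ε j) (∑ l, hadamard ε j l • u l))‖)]

/-- If a rounded number of successes is almost certain, then its measurement hardly disturbs the
state: undoing the Hadamard tests restores it with the square of that probability. -/
theorem sq_le_prob_aeUncompute (hψ : ‖ψ‖ = 1) (hT : T.IsSymmetricProjection) (hd : d ≠ 0)
    (ε : Fin (w + 1) ≃ (Fin d → Bool)) (hε : ε 0 = fun _ => false) (r : ℕ) (e : ℝ)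
    (o : Fin (w + 1)) :
    (∑ i, if aeLabel ε i = o then ∏ k, krausWeight (‖T ψ‖ ^ 2) (ε i k) else 0) ^ 2 ≤
      (aeUncompute ε (r + 1) e).prob (aeOracle ψ T) (fun _ v => Restored ψ v)
        (fun i => if aeLabel ε i = o then
          aeval (grover ψ T) (∏ k, krausPoly (ε i k)) ψ else 0) := by
  set W := ∑ i, if aeLabel ε i = o then ∏ k, krausWeight (‖T ψ‖ ^ 2) (ε i k) else 0 with hW
  rw [prob_aeUncompute]
  refine le_trans ?_ (Finset.single_le_sum (fun i _ => prob_nonneg _ _ _ _) (Finset.mem_univ 0))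
  rw [hadamard_untest ε hε]
  have hz : ∑ i, aeval (groverInv ψ T) (∏ k, krausPoly (ε i k)) (if aeLabel ε i = o then
      aeval (grover ψ T) (∏ k, krausPoly (ε i k)) ψ else 0) = (W : ℂ) • ψ := by
    rw [hW, Complex.ofReal_sum, Finset.sum_smul]
    refine Finset.sum_congr rfl fun i _ => ?_
    split_ifs
    · exact aeval_groverInv_prod_aeval_grover_prod hψ hT _ _ state_mem_aePlane
    · simp
  rw [hz]
  refine le_trans ?_ (le_prob_restoreLoop_succ hψ hd ε hε e r _)
  have hP : stateProj ψ ((W : ℂ) • ψ) = (W : ℂ) • ψ := by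
    rw [map_smul, stateProj_apply, inner_self_eq_ofReal, hψ]; simp
  rw [hP, norm_smul, hψ, Complex.norm_real, mul_one, Real.norm_eq_abs, sq_abs]
  exact le_add_of_nonneg_right (prob_nonneg _ _ _ _)

theorem val_aeLabel (hw : d ≤ w) (ε : Fin (w + 1) ≃ (Fin d → Bool)) (i : Fin (w + 1)) :
    (aeLabel ε i : ℕ) = roundCount d (falseCount (ε i)) := by
  have h := falseCount_le (ε i)
  have : roundCount d (falseCount (ε i)) < w + 1 := by
    unfold roundCount
    split_ifs <;> omega
  simp [aeLabel, Nat.mod_eq_of_lt this]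

theorem aeValue_aeLabel (hd : d ≠ 0) (hw : d ≤ w) (ε : Fin (w + 1) ≃ (Fin d → Bool))
    (i : Fin (w + 1)) :
    aeValue d (aeLabel ε i) = (roundCount d (falseCount (ε i)) : ℝ) / d := by
  rw [aeValue, val_aeLabel hw, min_eq_right]
  have h := falseCount_le (ε i)
  have h2 : roundCount d (falseCount (ε i)) ≤ d := by
    unfold roundCount
    split_ifs <;> omega
  exact div_le_one_of_le₀ (by exact_mod_cast h2) (by positivity)

theorem roundCount_eq_zero {a : ℕ} {p : ℝ} (hd : d ≠ 0) (h : |(a : ℝ) - d * p| < d * (1 / 72))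
    (hp : p ≤ 1 / 72) : roundCount d a = 0 := by
  have hd' : (0 : ℝ) < d := by positivity
  have h1 := (abs_lt.1 h).2
  have h2 : (36 * a : ℝ) < d := by nlinarith
  exact if_pos (by exact_mod_cast h2)

theorem roundCount_eq_self {a : ℕ} {p : ℝ} (hd : d ≠ 0) (h : |(a : ℝ) - d * p| < d * (1 / 72))
    (hp : 71 / 72 ≤ p) : roundCount d a = d := by
  have hd' : (0 : ℝ) < d := by positivity
  have h1 := (abs_lt.1 h).1
  have h2 : (35 * d : ℝ) < 36 * a := by nlinarith
  have h3 : 35 * d < 36 * a := by exact_mod_cast h2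
  unfold roundCount
  rw [if_neg (by omega), if_pos h3]

theorem abs_roundCount_sub_lt {a : ℕ} {p : ℝ} (hd : d ≠ 0) (ha : a ≤ d)
    (h : |(a : ℝ) - d * p| < d * (1 / 72)) : |(roundCount d a : ℝ) / d - p| < 1 / 18 := by
  have hd' : (0 : ℝ) < d := by positivity
  have h1 := abs_lt.1 h
  have h2 : |(roundCount d a : ℝ) - a| ≤ d * (1 / 36) := by
    unfold roundCount
    split_ifs with h3 h4
    · have : (36 * a : ℝ) < d := by exact_mod_cast h3
      rw [abs_le]
      constructor
      · push_cast; linarith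
      · push_cast; nlinarith [(Nat.cast_nonneg a : (0 : ℝ) ≤ a)]
    · have h5 : (35 * d : ℝ) < 36 * a := by exact_mod_cast h4
      have h6 : (a : ℝ) ≤ d := by exact_mod_cast ha
      rw [abs_le]
      constructor <;> linarith
    · simp
  have h4 := abs_le.1 h2
  rw [div_sub' hd'.ne', abs_div, abs_of_pos hd', div_lt_iff₀ hd', abs_lt]
  constructor <;> linarith

theorem three_mul_sqrt_two_sq : (3 * √2) ^ 2 = (18 : ℝ) := by
  rw [mul_pow, Real.sq_sqrt (by norm_num)]
  norm_num

theorem isNondestructiveAE_amplitudeEstimation (hd : d ≠ 0) (hw : d ≤ w)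
    (ε : Fin (w + 1) ≃ (Fin d → Bool)) (hε : ε 0 = fun _ => false) (r : ℕ) {C δ : ℝ}
    (hδ : 0 < δ)
    (h1 : 2 * Real.exp (-(d * (1 / 72) ^ 2 / 4)) ≤ δ / 2) (h2 : (19 / 20 : ℝ) ^ r ≤ δ)
    (hcost : (4 * d + 2 * (r + 1) : ℝ) ≤ C * (3 * √2 * Real.log (1 / δ))) :
    IsNondestructiveAE C (3 * √2) δ (amplitudeEstimation ε (r + 1)) := by
  have ht := three_mul_sqrt_two_sq
  refine ⟨?_, ?_, ?_, ?_, ?_⟩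
  · intro H _ _ ψ T hψ hT
    rw [probFrom, prob_congr_of_allOutputs (E' := fun _ _ => True) (fun a u ha => by simp [ha]) _
      (allOutputs_amplitudeEstimation ε (r + 1)), prob_true (norm_aeOracle hψ hT),
      sum_norm_sq_single, hψ, one_pow]
  · intro H _ _ ψ T hψ hT
    rw [probFrom_amplitudeEstimation_output hψ hT ε hε]
    refine le_trans ?_ (le_sum_prod_krausWeight (sq_nonneg _) (norm_proj_sq_le_one hψ hT)
      (c := 1 / 72) (by norm_num) (by norm_num) ε ?_)
    · linarith
    · intro i hi
      rw [aeValue_aeLabel hd hw, ht]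
      exact (abs_roundCount_sub_lt hd (falseCount_le _) hi).trans_le
        (le_add_of_nonneg_left (by positivity))
  · intro H _ _ ψ T hψ hT hp
    rw [probFrom_amplitudeEstimation_output hψ hT ε hε]
    refine le_trans ?_ (le_sum_prod_krausWeight (sq_nonneg _) (norm_proj_sq_le_one hψ hT)
      (c := 1 / 72) (by norm_num) (by norm_num) ε ?_)
    · linarith
    · intro i hi
      rw [ht] at hp
      rw [aeValue_aeLabel hd hw, roundCount_eq_zero hd hi (hp.trans_eq (by norm_num))]
      simp
  · intro H _ _ ψ T hψ hT
    rw [probFrom_amplitudeEstimation ε hε]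
    -- an outcome that is almost certain when `p` is close to `0` or `1`
    have hcertain : ∀ m : ℕ, m ≤ d → (∀ i, |falseCount (ε i) - d * ‖T ψ‖ ^ 2| < d * (1 / 72) →
        roundCount d (falseCount (ε i)) = m) →
        1 - δ ≤ ∑ o, (aeUncompute ε (r + 1) (aeValue d o)).prob (aeOracle ψ T)
          (fun _ u => Restored ψ u) (fun i => if aeLabel ε i = o then
            aeval (grover ψ T) (∏ k, krausPoly (ε i k)) ψ else 0) := by
      intro m hm hi
      have hmw : m < w + 1 := by omega
      refine le_trans ?_ (Finset.single_le_sum (fun i _ => prob_nonneg _ _ _ _)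
        (Finset.mem_univ (⟨m, hmw⟩ : Fin (w + 1))))
      refine le_trans ?_ (sq_le_prob_aeUncompute hψ hT hd ε hε r _ _)
      have h3 : 1 - 2 * Real.exp (-(d * (1 / 72) ^ 2 / 4)) ≤
          ∑ i, if aeLabel ε i = ⟨m, hmw⟩ then ∏ k, krausWeight (‖T ψ‖ ^ 2) (ε i k) else 0 := by
        convert le_sum_prod_krausWeight (sq_nonneg _) (norm_proj_sq_le_one hψ hT) (c := 1 / 72)
          (by norm_num) (by norm_num) ε (F := fun i => aeLabel ε i = ⟨m, hmw⟩)
          (fun i h => Fin.ext ((val_aeLabel hw ε i).trans (hi i h)))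
      nlinarith [sq_nonneg ((∑ i, if aeLabel ε i = ⟨m, hmw⟩ then
        ∏ k, krausWeight (‖T ψ‖ ^ 2) (ε i k) else 0) - 1)]
    rcases le_or_gt (‖T ψ‖ ^ 2) (1 / 72) with hp | hp
    · exact hcertain 0 (Nat.zero_le d) fun i hi => roundCount_eq_zero hd hi hp
    rcases le_or_gt (71 / 72) (‖T ψ‖ ^ 2) with hp' | hp'
    · exact hcertain d le_rfl fun i hi => roundCount_eq_self hd hi hp'
    have h3 : (1 - 4 * ‖T ψ‖ ^ 2 * (1 - ‖T ψ‖ ^ 2)) ^ r ≤ δ := by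
      refine le_trans (pow_le_pow_left₀ ?_ ?_ r) h2
      · nlinarith [sq_nonneg (1 - 2 * ‖T ψ‖ ^ 2)]
      · nlinarith
    have hnorm : ∑ o, ∑ i, ‖if aeLabel ε i = o then
        aeval (grover ψ T) (∏ k, krausPoly (ε i k)) ψ else 0‖ ^ 2 = 1 := by
      rw [sum_norm_sq_meas, sum_norm_sq_aeval (norm_grover hψ hT) ε hε, hψ, one_pow]
    calc 1 - δ ≤ (1 - (1 - 4 * ‖T ψ‖ ^ 2 * (1 - ‖T ψ‖ ^ 2)) ^ r) *
          ∑ o, ∑ i, ‖if aeLabel ε i = o then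
            aeval (grover ψ T) (∏ k, krausPoly (ε i k)) ψ else 0‖ ^ 2 := by
          rw [hnorm]; linarith
      _ ≤ _ := by
          rw [Finset.mul_sum]
          refine Finset.sum_le_sum fun o _ => le_prob_aeUncompute hψ hT hd ε hε r _ fun i => ?_
          split_ifs
          · exact aeval_prod_krausPoly_mem hT _ _ state_mem_aePlane
          · exact Submodule.zero_mem _
  · refine le_trans ?_ hcost
    exact_mod_cast queries_amplitudeEstimation_le ε (r + 1)

/-- An identification of the basis states of a workspace with bit strings, for which the initial
state of the workspace is the zero string. -/
theorem exists_equiv_bits (d : ℕ) :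
    ∃ ε : Fin (2 ^ d - 1 + 1) ≃ (Fin d → Bool), ε 0 = fun _ => false := by
  have hcard : Fintype.card (Fin d → Bool) = 2 ^ d - 1 + 1 := by
    have := Nat.one_le_two_pow (n := d)
    simp
    omega
  let e := (Fintype.equivFinOfCardEq hcard).symm
  exact ⟨e.trans (Equiv.swap (e 0) fun _ => false), by simp⟩

/-- Amplitude estimation with `O(log (1 / δ))` Hadamard tests and rounds of restoring. -/
theorem exists_isNondestructiveAE (δ : ℝ) :
    ∃ (w : ℕ) (N : QProg AEQuery w ℝ), 0 < δ → δ < 1 / 2 →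
      IsNondestructiveAE 250000 (3 * √2) δ N := by
  -- the Chernoff bound `2 exp (-d (1/72) ^ 2 / 4)` is to be at most `δ / 2`, and
  -- `20736 = 4 * 72 ^ 2`
  set d := ⌈20736 * Real.log (4 / δ)⌉₊ with hd
  -- for `1/72 < p < 71/72` a round of restoring succeeds with probability at least `1/20`
  set r := ⌈20 * Real.log (1 / δ)⌉₊ with hr
  obtain ⟨ε, hε⟩ := exists_equiv_bits d
  refine ⟨_, amplitudeEstimation ε (r + 1), fun h0 h1 => ?_⟩
  have hL : Real.log (1 / δ) = -Real.log δ := by rw [one_div, Real.log_inv]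
  have hlog2 := Real.log_two_gt_d9
  have hL2 : Real.log 2 ≤ Real.log (1 / δ) :=
    Real.log_le_log (by norm_num) (by rw [le_div_iff₀ h0]; linarith)
  have hL4 : Real.log (4 / δ) = 2 * Real.log 2 + Real.log (1 / δ) := by
    rw [Real.log_div (by norm_num) h0.ne', hL, show (4 : ℝ) = 2 ^ 2 by norm_num, Real.log_pow]
    push_cast
    ring
  have hd1 : 20736 * Real.log (4 / δ) ≤ d := Nat.le_ceil _
  have hd2 : (d : ℝ) < 20736 * Real.log (4 / δ) + 1 := Nat.ceil_lt_add_one (by linarith)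
  have hr1 : 20 * Real.log (1 / δ) ≤ r := Nat.le_ceil _
  have hr2 : (r : ℝ) < 20 * Real.log (1 / δ) + 1 := Nat.ceil_lt_add_one (by linarith)
  have hd0 : d ≠ 0 := by
    rintro h
    rw [h] at hd1
    push_cast at hd1
    linarith
  refine isNondestructiveAE_amplitudeEstimation hd0 (Nat.le_sub_one_of_lt Nat.lt_two_pow_self)
    ε hε r h0 ?_ ?_ ?_
  · calc 2 * Real.exp (-(d * (1 / 72) ^ 2 / 4)) ≤ 2 * Real.exp (-Real.log (4 / δ)) := by
          gcongr
          linarith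
      _ = δ / 2 := by
          rw [Real.exp_neg, Real.exp_log (by positivity)]
          field_simp
          norm_num
  · have h19 : (19 / 20 : ℝ) ≤ Real.exp (-(1 / 20)) := by
      have := Real.add_one_le_exp (-(1 / 20) : ℝ)
      linarith
    calc (19 / 20 : ℝ) ^ r ≤ Real.exp (-(1 / 20)) ^ r := by gcongr
      _ = Real.exp (-(r / 20)) := by rw [← Real.exp_nat_mul]; ring_nf
      _ ≤ Real.exp (Real.log δ) := by
          gcongr
          linarith
      _ = δ := Real.exp_log h0
  · have hs : (1 : ℝ) ≤ √2 := Real.one_le_sqrt.2 (by norm_num)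
    have h3 : Real.log (1 / δ) ≤ √2 * Real.log (1 / δ) :=
      le_mul_of_one_le_left (by linarith) hs
    linarith

end QProg

theorem IsNondestructiveAE.mono {C C' t δ : ℝ} {w : ℕ} {N : QProg AEQuery w ℝ}
    (h : IsNondestructiveAE C t δ N) (hC : C ≤ C') (ht : 0 ≤ t) (h0 : 0 < δ) (h1 : δ ≤ 1) :
    IsNondestructiveAE C' t δ N where
  range := h.range
  accuracy := h.accuracy
  zero := h.zero
  restores := h.restores
  cost := h.cost.trans <| mul_le_mul_of_nonneg_right hC <|
    mul_nonneg ht (Real.log_nonneg ((one_le_div h0).2 h1))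

/-! ### Qsamples and tail probabilities -/

section Qsample

variable {Ω : Type*} [MeasurableSpace Ω] {P : Measure Ω} {X : Ω → ℝ} {S : Finset ℝ}

open Classical in
theorem sum_measureReal_preimage [IsProbabilityMeasure P] (hX : AEMeasurable X P)
    (hS : IsFiniteSupport P X S) (B : Set ℝ) :
    ∑ x : S, (if (x : ℝ) ∈ B then P.real (X ⁻¹' {(x : ℝ)}) else 0) = P.real (X ⁻¹' B) := by
  have hmap : ∀ A : Set ℝ, MeasurableSet A → P.real (X ⁻¹' A) = (P.map X).real A := fun A hA => by
    rw [measureReal_def, measureReal_def, Measure.map_apply_of_aemeasurable hX hA]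
  have := Measure.isProbabilityMeasure_map hX
  have h1 : P.real (X ⁻¹' B) = P.real (X ⁻¹' ↑(S.filter (· ∈ B))) := by
    refine measureReal_congr ?_
    filter_upwards [hS.ae_mem] with ω hω
    refine propext (?_ : X ω ∈ B ↔ X ω ∈ (↑(S.filter (· ∈ B)) : Set ℝ))
    simp [hω]
  rw [h1, hmap _ (Finset.measurableSet _), ← sum_measureReal_singleton, Finset.sum_filter,
    ← Finset.sum_coe_sort S fun x => if x ∈ B then (P.map X).real {x} else 0]
  refine Finset.sum_congr rfl fun x _ => ?_
  rw [hmap _ (measurableSet_singleton _)]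

theorem norm_tailProj_qsample_sq [IsProbabilityMeasure P] (hX : AEMeasurable X P)
    (hS : IsFiniteSupport P X S) (y : ℝ) :
    ‖tailProj S y (qsample P X S)‖ ^ 2 = P.real {ω | y ≤ X ω} := by
  have h := sum_measureReal_preimage hX hS (Set.Ici y)
  change _ = P.real (X ⁻¹' Set.Ici y)
  rw [← h, EuclideanSpace.norm_sq_eq]
  refine Finset.sum_congr rfl fun x _ => ?_
  simp only [tailProj, qsample, Set.mem_Ici, LinearMap.coe_mk, AddHom.coe_mk]
  split_ifs
  · rw [Complex.norm_real, Real.norm_eq_abs, sq_abs, Real.sq_sqrt measureReal_nonneg]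
  · simp

theorem norm_qsample [IsProbabilityMeasure P] (hX : AEMeasurable X P)
    (hS : IsFiniteSupport P X S) : ‖qsample P X S‖ = 1 := by
  have h := sum_measureReal_preimage hX hS Set.univ
  have h2 : ‖qsample P X S‖ ^ 2 = 1 := by
    rw [EuclideanSpace.norm_sq_eq]
    simp only [Set.mem_univ, if_true, Set.preimage_univ, probReal_univ] at h
    rw [← h]
    refine Finset.sum_congr rfl fun x _ => ?_
    simp only [qsample]
    rw [Complex.norm_real, Real.norm_eq_abs, sq_abs, Real.sq_sqrt measureReal_nonneg]
  exact (pow_eq_one_iff_of_nonneg (norm_nonneg _) two_ne_zero).1 h2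

theorem tailProj_isSymmetricProjection (S : Finset ℝ) (y : ℝ) :
    (tailProj S y).IsSymmetricProjection where
  isIdempotentElem := by
    ext v x
    by_cases h : y ≤ (x : ℝ) <;> simp [tailProj, h]
  isSymmetric u v := by
    simp only [PiLp.inner_apply, tailProj, LinearMap.coe_mk, AddHom.coe_mk]
    refine Finset.sum_congr rfl fun x _ => ?_
    split_ifs <;> simp

theorem mediOracle_comp_aeToMedi (S : Finset ℝ) (ψ : EuclideanSpace ℂ S) (y : ℝ) :
    (fun q => mediOracle S ψ (aeToMedi y q)) = aeOracle ψ (tailProj S y) := by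
  funext q
  cases q <;> rfl

theorem norm_mediOracle {ψ : EuclideanSpace ℂ S} (hψ : ‖ψ‖ = 1) (q : MediQuery)
    (v : EuclideanSpace ℂ S) : ‖mediOracle S ψ q v‖ = ‖v‖ := by
  cases q with
  | qsample => exact norm_aeOracle hψ (tailProj_isSymmetricProjection S 0) .state v
  | tail y => exact norm_reflProj (tailProj_isSymmetricProjection S y) v

theorem mediOracle_smul (ψ : EuclideanSpace ℂ S) (q : MediQuery) (c : ℂ)
    (v : EuclideanSpace ℂ S) : mediOracle S ψ q (c • v) = c • mediOracle S ψ q v := by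
  cases q with
  | qsample => exact aeOracle_smul ψ (tailProj S 0) .state c v
  | tail y => exact reflProj_smul _ c v

/-! ### Approximate medians are close to the mean -/

theorem supportValue_add_one (S : Finset ℝ) (i : Fin S.card) :
    supportValue S (i + 1) = S.orderEmbOfFin rfl i := by
  simp [supportValue, Finset.orderEmbOfFin_apply]

theorem exists_supportValue_eq {x : ℝ} (hx : x ∈ S) :
    ∃ i : Fin S.card, supportValue S (i + 1) = x := by
  have : x ∈ Set.range (S.orderEmbOfFin rfl) := by
    rw [Finset.range_orderEmbOfFin]; exact hx
  obtain ⟨i, hi⟩ := this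
  exact ⟨i, by rw [supportValue_add_one, hi]⟩

theorem supportValue_one_le {x : ℝ} (hx : x ∈ S) : supportValue S 1 ≤ x := by
  obtain ⟨i, rfl⟩ := exists_supportValue_eq hx
  have hpos : 0 < S.card := i.pos
  have h := supportValue_add_one S ⟨0, hpos⟩
  rw [zero_add] at h
  rw [h, supportValue_add_one]
  exact (S.orderEmbOfFin rfl).monotone (Fin.mk_le_of_le_val (Nat.zero_le _))

/-- No value of the support lies strictly between two consecutive ones, or above the last one. -/
theorem supportValue_succ_le {x : ℝ} (hx : x ∈ S) {k : ℕ} (hk0 : 1 ≤ k)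
    (h : supportValue S k < x) : k < S.card ∧ supportValue S (k + 1) ≤ x ∨ S.card < k := by
  obtain ⟨i, rfl⟩ := exists_supportValue_eq hx
  obtain ⟨j, rfl⟩ := Nat.exists_eq_add_of_le' hk0
  rcases le_or_gt (j + 1) S.card with hj | hj
  · left
    have e1 := supportValue_add_one S ⟨j, hj⟩
    rw [e1, supportValue_add_one] at h
    have h2 : j < (i : ℕ) := (S.orderEmbOfFin rfl).lt_iff_lt.1 h
    have h3 : j + 1 < S.card := lt_of_le_of_lt h2 i.2
    have e2 := supportValue_add_one S ⟨j + 1, h3⟩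
    refine ⟨h3, ?_⟩
    rw [e2, supportValue_add_one]
    exact (S.orderEmbOfFin rfl).monotone (Fin.mk_le_of_le_val h2)
  · exact Or.inr hj

/-- By Chebyshev's inequality, a value `m` with more than `1/18` of the probability on either side
is within `17` standard deviations of the mean. -/
theorem abs_mean_sub_le [IsProbabilityMeasure P] (hX : MemLp X 2 P) {m : ℝ}
    (h1 : 1 / 18 < P.real {ω | m ≤ X ω}) (h2 : P.real {ω | m < X ω} < 1 / 3) :
    |P[X] - m| ≤ 17 * √(Var[X; P]) := by
  by_contra! hlt
  have hσ := Real.sqrt_nonneg (Var[X; P])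
  have hs : 0 < |P[X] - m| := lt_of_le_of_lt (by positivity) hlt
  have hcheb := meas_ge_le_variance_div_sq hX hs
  have hcheb' : P.real {ω | |P[X] - m| ≤ |X ω - P[X]|} ≤ Var[X; P] / |P[X] - m| ^ 2 :=
    ENNReal.toReal_le_of_le_ofReal (div_nonneg (variance_nonneg _ _) (sq_nonneg _)) hcheb
  have hbig : 1 / 18 < P.real {ω | |P[X] - m| ≤ |X ω - P[X]|} := by
    rcases le_total m (P[X]) with hm | hm
    · have hu : (1 : ℝ) ≤ P.real {ω | X ω ≤ m} + P.real {ω | m < X ω} := by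
        refine le_trans (le_of_eq ?_) (measureReal_union_le _ _)
        rw [← probReal_univ (μ := P)]
        congr 1
        ext ω
        simp [le_or_gt]
      have hsub : P.real {ω | X ω ≤ m} ≤ P.real {ω | |P[X] - m| ≤ |X ω - P[X]|} := by
        refine measureReal_mono fun ω hω => ?_
        rw [Set.mem_ofPred_eq] at hω ⊢
        rw [abs_of_nonneg (sub_nonneg.2 hm), abs_of_nonpos (by linarith)]
        linarith
      linarith
    · refine h1.trans_le (measureReal_mono fun ω hω => ?_)
      rw [Set.mem_ofPred_eq] at hω ⊢
      rw [abs_of_nonpos (sub_nonpos.2 hm), abs_of_nonneg (by linarith)]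
      linarith
  have h3 : 1 / 18 < Var[X; P] / |P[X] - m| ^ 2 := hbig.trans_le hcheb'
  rw [lt_div_iff₀ (by positivity)] at h3
  have h4 := Real.sq_sqrt (variance_nonneg X P)
  nlinarith

theorem memLp_of_isFiniteSupport [IsProbabilityMeasure P] (hX : AEMeasurable X P)
    (hS : IsFiniteSupport P X S) : MemLp X 2 P := by
  refine MemLp.of_bound hX.aestronglyMeasurable (∑ x ∈ S, |x|) ?_
  filter_upwards [hS.ae_mem] with ω hω
  exact Finset.single_le_sum (f := fun x : ℝ => |x|) (fun x _ => abs_nonneg x) hω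

/-- The invariant of the binary search with bounds `a` and `b`: more than `1/18` of the probability
lies at or above `x_{a-1}`, and less than `1/3` of it at or above `x_b`. -/
structure SearchInvariant (P : Measure Ω) (X : Ω → ℝ) (S : Finset ℝ) (a b : ℕ) : Prop where
  lower : a = 1 ∨ 1 / 18 < P.real {ω | supportValue S (a - 1) ≤ X ω}
  upper : b = S.card + 1 ∨ P.real {ω | supportValue S b ≤ X ω} < 1 / 3

theorem SearchInvariant.abs_mean_sub_le [IsProbabilityMeasure P] (hX : AEMeasurable X P)
    (hS : IsFiniteSupport P X S) {a : ℕ} (h1 : 1 ≤ a) (h2 : a ≤ S.card + 1)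
    (h : SearchInvariant P X S a a) :
    |P[X] - supportValue S (a - 1)| ≤ 17 * √(Var[X; P]) := by
  have hne : S.card ≠ 0 := by
    intro h0
    obtain ⟨ω, hω⟩ := hS.ae_mem.exists
    rw [Finset.card_eq_zero.1 h0] at hω
    exact absurd hω (Finset.notMem_empty _)
  have hone : P.real {ω | supportValue S 1 ≤ X ω} = 1 := by
    rw [← probReal_univ (μ := P)]
    refine measureReal_congr ?_
    filter_upwards [hS.ae_mem] with ω hω
    exact propext (iff_true_intro (supportValue_one_le hω) : supportValue S 1 ≤ X ω ↔ True)
  -- `a = b = 1` would mean that `Pr[X ≥ x_1]`, which is `1`, has been found to be less than `1/3`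
  have ha : a ≠ 1 := by
    rintro rfl
    rcases h.upper with h | h
    · omega
    · rw [hone] at h; norm_num at h
  refine _root_.abs_mean_sub_le (memLp_of_isFiniteSupport hX hS) (h.lower.resolve_left ha) ?_
  obtain ⟨k, rfl⟩ := Nat.exists_eq_add_of_le' h1
  rw [Nat.add_sub_cancel]
  have hk : 1 ≤ k := by omega
  rcases h.upper with hu | hu
  · have : P.real {ω | supportValue S k < X ω} = P.real ∅ := by
      refine measureReal_congr ?_
      filter_upwards [hS.ae_mem] with ω hω
      refine propext (iff_false_intro (fun hlt => ?_) : supportValue S k < X ω ↔ False)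
      rcases supportValue_succ_le hω hk hlt with ⟨h, _⟩ | h <;> omega
    rw [this]
    simp
  · refine lt_of_le_of_lt ?_ hu
    refine ENNReal.toReal_mono (measure_ne_top _ _) (measure_mono_ae ?_)
    filter_upwards [hS.ae_mem] with ω hω hlt
    rcases supportValue_succ_le hω hk hlt with ⟨_, h⟩ | h
    · exact h
    · omega

/-! ### The binary search -/

/-- The estimate `e` of the probability `q` has the accuracy that amplitude estimation with time
parameter `3 √2` guarantees. -/
def AccurateEstimate (q e : ℝ) : Prop := |e - q| < √(q * (1 - q)) / (3 * √2) + 1 / (3 * √2) ^ 2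

theorem AccurateEstimate.exists_deviation {q e : ℝ} (h0 : 0 ≤ q) (h1 : q ≤ 1)
    (h : AccurateEstimate q e) :
    ∃ s, 0 ≤ s ∧ s ^ 2 = q * (1 - q) / 18 ∧ |e - q| < s + 1 / 18 := by
  refine ⟨√(q * (1 - q)) / (3 * √2), by positivity, ?_, ?_⟩
  · rw [div_pow, Real.sq_sqrt (mul_nonneg h0 (by linarith)), QProg.three_mul_sqrt_two_sq]
  · rw [← QProg.three_mul_sqrt_two_sq]
    exact h

theorem AccurateEstimate.lt_third {q e : ℝ} (h0 : 0 ≤ q) (h1 : q ≤ 1) (h : AccurateEstimate q e)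
    (he : e ≤ 1 / 6) : q < 1 / 3 := by
  obtain ⟨s, hs0, hs, hlt⟩ := h.exists_deviation h0 h1
  have h5 := (abs_lt.1 hlt).1
  by_contra! hq
  -- for `q = 1 / 3` the deviation `s` would be exactly `q - 2 / 9`
  have h6 : q - 2 / 9 < s := by linarith
  have h7 : (q - 2 / 9) ^ 2 < s ^ 2 := by gcongr; linarith
  nlinarith

theorem AccurateEstimate.gt_eighteenth {q e : ℝ} (h0 : 0 ≤ q) (h1 : q ≤ 1)
    (h : AccurateEstimate q e) (he : 1 / 6 < e) : 1 / 18 < q := by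
  obtain ⟨s, hs0, hs, hlt⟩ := h.exists_deviation h0 h1
  have h5 := (abs_lt.1 hlt).2
  by_contra! hq
  have h6 : 1 / 9 - q < s := by linarith
  have h7 : (1 / 9 - q) ^ 2 < s ^ 2 := by gcongr; linarith
  nlinarith

/-- The binary search on a range of less than `2 ^ r` indices takes at most `r` rounds, each of
which spoils the estimate or the state with probability at most `2 δ`. -/
theorem le_probFrom_mediSearch [IsProbabilityMeasure P] (hX : AEMeasurable X P)
    (hS : IsFiniteSupport P X S) {w : ℕ} {N : QProg AEQuery w ℝ} {C δ : ℝ}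
    (hN : IsNondestructiveAE C (3 * √2) δ N) (hδ : 0 ≤ δ) {r : ℕ} (hr : 2 * δ * r ≤ 1) {a b : ℕ}
    (ha : 1 ≤ a) (hab : a ≤ b) (hb : b ≤ S.card + 1) (hlen : b - a < 2 ^ r)
    (hI : SearchInvariant P X S a b) :
    1 - 2 * δ * r ≤ (mediSearch N S a b).probFrom (mediOracle S (qsample P X S)) (qsample P X S)
      (fun m u => |P[X] - m| ≤ 17 * √(Var[X; P]) ∧ QProg.Restored (qsample P X S) u) := by
  have hψ := norm_qsample hX hS
  induction r generalizing a b with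
  | zero =>
    obtain rfl : a = b := by
      rw [pow_zero] at hlen
      omega
    have h1 := hI.abs_mean_sub_le hX hS ha hb
    have h2 : QProg.Restored (qsample P X S)
        (Pi.single 0 (qsample P X S) : Fin (w + 1) → EuclideanSpace ℂ S) :=
      ⟨Pi.single 0 1, fun i => by
        rcases eq_or_ne i 0 with rfl | hi
        · simp
        · simp [hi]⟩
    rw [mediSearch, dif_neg (lt_irrefl a), QProg.probFrom, QProg.prob, if_pos ⟨h1, h2⟩,
      QProg.sum_norm_sq_single, hψ]
    simp
  | succ r ih =>
    have hr' : 2 * δ * r ≤ 1 := by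
      push_cast at hr
      linarith
    rcases hab.eq_or_lt with rfl | hlt
    · refine le_trans ?_ (ih hr' ha le_rfl hb (by simp) hI)
      push_cast
      linarith
    set k := (a + b) / 2 with hk
    set ψ := qsample P X S with hψdef
    set q := P.real {ω | supportValue S k ≤ X ω} with hq
    have hTq : ‖tailProj S (supportValue S k) ψ‖ ^ 2 = q := norm_tailProj_qsample_sq hX hS _
    have hT := tailProj_isSymmetricProjection S (supportValue S k)
    have hq0 : 0 ≤ q := measureReal_nonneg
    have hq1 : q ≤ 1 := measureReal_le_one
    rw [mediSearch, dif_pos hlt]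
    have hbind := QProg.le_prob_bind (norm_mediOracle hψ) (mediOracle_smul ψ)
      (E := fun m u => |P[X] - m| ≤ 17 * √(Var[X; P]) ∧ QProg.Restored ψ u)
      (fun m c u hc => by rw [QProg.restored_smul_iff ψ hc]) hψ (G := AccurateEstimate q)
      (k := fun e => if e ≤ 1 / 6 then mediSearch N S a k else mediSearch N S (k + 1) b)
      (c := 1 - 2 * δ * r)
      (fun e he => by
        split_ifs with h6
        · refine ih hr' ha (by omega) (by omega) ?_ ⟨hI.lower, Or.inr (he.lt_third hq0 hq1 h6)⟩
          rw [pow_succ] at hlen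
          omega
        · refine ih hr' (by omega) (by omega) hb ?_
            ⟨Or.inr (he.gt_eighteenth hq0 hq1 (not_le.1 h6)), hI.upper⟩
          rw [pow_succ] at hlen
          omega)
      (N.rename (aeToMedi (supportValue S k))) (Pi.single 0 ψ)
    refine le_trans ?_ hbind
    rw [QProg.prob_rename, mediOracle_comp_aeToMedi]
    have h1 := hN.accuracy _ ψ _ hψ hT
    have h2 := hN.restores _ ψ _ hψ hT
    rw [hTq] at h1
    have h3 := QProg.prob_add_le_prob_and (aeOracle ψ (tailProj S (supportValue S k)))
      (fun e _ => AccurateEstimate q e) (fun _ u => QProg.Restored ψ u) N (Pi.single 0 ψ)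
    rw [QProg.prob_true (norm_aeOracle hψ hT), QProg.sum_norm_sq_single, hψ] at h3
    have h4 : 1 - 2 * δ ≤ N.prob (aeOracle ψ (tailProj S (supportValue S k)))
        (fun e u => AccurateEstimate q e ∧ QProg.Restored ψ u) (Pi.single 0 ψ) := by
      unfold QProg.probFrom at h1 h2
      unfold AccurateEstimate at h3 ⊢
      linarith
    have h5 := mul_le_mul_of_nonneg_right h4 (sub_nonneg.2 hr')
    refine le_trans ?_ h5
    have h6 : 0 ≤ δ ^ 2 * (r : ℝ) := by positivity
    push_cast
    nlinarith

theorem queries_mediSearch_le {w : ℕ} (N : QProg AEQuery w ℝ) (S : Finset ℝ) {r a b : ℕ}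
    (hlen : b - a < 2 ^ r) :
    (mediSearch N S a b).queries mediCost ≤ r * N.queries (fun _ => 1) := by
  induction r generalizing a b with
  | zero =>
    rw [mediSearch, dif_neg (by rw [pow_zero] at hlen; omega)]
    simp [QProg.queries]
  | succ r ih =>
    rw [mediSearch]
    split_ifs with hlt
    · refine (QProg.queries_bind_le mediCost _ _ (m := r * N.queries (fun _ => 1)) ?_).trans ?_
      · intro e
        rw [pow_succ] at hlen
        split_ifs
        · exact ih (by omega)
        · exact ih (by omega)
      · rw [QProg.queries_rename, add_mul, one_mul, add_comm]
        gcongr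
        refine QProg.queries_mono (fun q => ?_) N
        cases q <;> simp [aeToMedi, mediCost]
    · simp [QProg.queries]

/-- The number of rounds times the cost of a round. -/
theorem rounds_mul_cost_le {n : ℕ} (hn : 1 ≤ n) {η : ℝ} (h0 : 0 < η) (h1 : η < 1) :
    ((Nat.log 2 n + 1 : ℕ) : ℝ) * (250000 * (3 * √2 * Real.log (1 / mediDelta n η))) ≤
      3375000 * ((1 + Real.log n) * (1 + Real.log ((1 + Real.log n) / η))) := by
  set m : ℝ := ((Nat.log 2 n + 1 : ℕ) : ℝ) with hm
  have hn' : (1 : ℝ) ≤ n := by exact_mod_cast hn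
  have hlogn : 0 ≤ Real.log n := Real.log_nonneg hn'
  have hm1 : 1 ≤ m := by
    rw [hm]
    exact_mod_cast Nat.le_add_left 1 _
  have hm2 : m ≤ 3 / 2 * (1 + Real.log n) := by
    have h2 : (Nat.log 2 n : ℝ) ≤ Real.log n / Real.log 2 := by
      have := Real.natLog_le_logb n 2
      rwa [Real.logb] at this
    have hlog2 := Real.log_two_gt_d9
    have h3 : Real.log n / Real.log 2 ≤ 3 / 2 * Real.log n := by
      rw [div_le_iff₀ (by linarith)]
      nlinarith
    rw [hm]
    push_cast
    linarith
  have hpos : 0 < (1 + Real.log n) / η := by positivity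
  have hone : 1 ≤ (1 + Real.log n) / η := by rw [one_le_div h0]; linarith
  have hl0 : 0 ≤ Real.log ((1 + Real.log n) / η) := Real.log_nonneg hone
  have hlog : Real.log (1 / mediDelta n η) ≤ 2 * (1 + Real.log ((1 + Real.log n) / η)) := by
    have h2 : 1 / mediDelta n η ≤ 3 * ((1 + Real.log n) / η) := by
      rw [mediDelta, ← hm, one_div_div, ← mul_div_assoc]
      rw [div_le_div_iff_of_pos_right h0]
      linarith
    have h3 : 0 < 1 / mediDelta n η := by
      rw [mediDelta, ← hm]
      positivity
    have h4 : Real.log 3 ≤ 2 := by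
      have := Real.log_le_sub_one_of_pos (show (0 : ℝ) < 3 by norm_num)
      linarith
    calc Real.log (1 / mediDelta n η) ≤ Real.log (3 * ((1 + Real.log n) / η)) :=
          Real.log_le_log h3 h2
      _ = Real.log 3 + Real.log ((1 + Real.log n) / η) :=
          Real.log_mul (by norm_num) hpos.ne'
      _ ≤ _ := by linarith
  have hlog0 : 0 ≤ Real.log (1 / mediDelta n η) := by
    refine Real.log_nonneg ?_
    rw [mediDelta, ← hm, one_div_div, one_le_div h0]
    linarith
  have hs : √2 ≤ 3 / 2 := by rw [Real.sqrt_le_left (by norm_num)]; norm_num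
  calc m * (250000 * (3 * √2 * Real.log (1 / mediDelta n η)))
      ≤ 3 / 2 * (1 + Real.log n) * (250000 * (3 * (3 / 2) *
          (2 * (1 + Real.log ((1 + Real.log n) / η))))) := by
        gcongr
    _ = _ := by ring

end Qsample

theorem proposition3p2 :
    ∃ (C : ℝ) (w : ℝ → ℕ) (ndae : (δ : ℝ) → QProg AEQuery (w δ) ℝ),
      (∀ δ : ℝ, 0 < δ → δ < 1 / 2 → IsNondestructiveAE C (3 * √2) δ (ndae δ)) ∧
      ∀ (Ω : Type*) [MeasurableSpace Ω] (P : Measure Ω) [IsProbabilityMeasure P] (X : Ω → ℝ)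
        (S : Finset ℝ) (n : ℕ) (η : ℝ),
        AEMeasurable X P → IsFiniteSupport P X S → S.card = n → 0 < η → η < 1 →
          1 - η ≤ (medi (ndae (mediDelta n η)) S).probFrom (mediOracle S (qsample P X S))
              (qsample P X S) (fun m _ => |P[X] - m| ≤ 17 * √(Var[X; P])) ∧
          1 - η ≤ (medi (ndae (mediDelta n η)) S).probFrom (mediOracle S (qsample P X S))
              (qsample P X S) (fun _ u => QProg.Restored (qsample P X S) u) ∧
          ((medi (ndae (mediDelta n η)) S).queries mediCost : ℝ) ≤
            C * ((1 + Real.log n) * (1 + Real.log ((1 + Real.log n) / η))) := by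
  choose w ndae hndae using QProg.exists_isNondestructiveAE
  refine ⟨3375000, w, ndae, fun δ h0 h1 => (hndae δ h0 h1).mono (by norm_num) (by positivity) h0
    (by linarith), ?_⟩
  intro Ω _ P _ X S n η hX hS hn h0 h1
  have hn1 : 1 ≤ n := by
    obtain ⟨ω, hω⟩ := hS.ae_mem.exists
    rw [← hn]
    exact Finset.card_pos.2 ⟨_, hω⟩
  have hm : (1 : ℝ) ≤ (Nat.log 2 n + 1 : ℕ) := by exact_mod_cast Nat.le_add_left 1 _
  have hδ0 : 0 < mediDelta n η := by unfold mediDelta; positivity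
  have hδr : 2 * mediDelta n η * (Nat.log 2 n + 1 : ℕ) = η := by
    unfold mediDelta
    field_simp
  have hδ1 : mediDelta n η < 1 / 2 := by nlinarith
  have hN := hndae _ hδ0 hδ1
  have hlen : S.card + 1 - 1 < 2 ^ (Nat.log 2 n + 1) := by
    rw [Nat.add_sub_cancel, hn]
    exact Nat.lt_pow_succ_log_self one_lt_two n
  have hprob := le_probFrom_mediSearch hX hS hN hδ0.le (hδr.trans_le h1.le) le_rfl
    (Nat.le_add_left 1 _) le_rfl hlen ⟨Or.inl rfl, Or.inl rfl⟩
  rw [hδr] at hprob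
  refine ⟨hprob.trans (QProg.prob_mono _ (fun _ _ h => h.1) _ _),
    hprob.trans (QProg.prob_mono _ (fun _ _ h => h.2) _ _), ?_⟩
  have hq : ((medi (ndae (mediDelta n η)) S).queries mediCost : ℝ) ≤
      (Nat.log 2 n + 1 : ℕ) * ((ndae (mediDelta n η)).queries (fun _ => 1) : ℝ) := by
    exact_mod_cast queries_mediSearch_le (ndae (mediDelta n η)) S hlen
  exact hq.trans ((mul_le_mul_of_nonneg_left hN.cost (by linarith)).trans
    (rounds_mul_cost_le hn1 h0 h1))
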